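/- Let $n\ge 0$ be an integer, $\beta\ge 0$, $G>0$, and let $\mathcal X=\prod_{i=1}^n \mathcal X_i\subseteq\mathbb R^n$, where each $\mathcal X_i\subseteq\mathbb R$ is compact, convex and contains $0$. Let $\mathcal F$ be the class of differentiable functions $f:\mathcal X\to[0,1]$, given with their gradient $\nabla f$ on $\mathcal X$, that are monotone ($f(x)\le f(y)$ if $x\le y$ coordinatewise), DR-submodular ($\nabla f(x)\ge\nabla f(y)$ coordinatewise if $x\le y$), $\beta$-smooth ($\|\nabla f(x)-\nabla f(y)\|_2\le\beta\|x-y\|_2$) and satisfy $\|\nabla f(x)\|_2\le G$ on $\mathcal X$. For a horizon $T\ge 2$ and a privacy parameter $\varepsilon>0$, put $K=\Big\lceil\sqrt{\sqrt T/\log^{2.5}T}\,\Big\rceil$ and $\varepsilon'=\varepsilon/K$. PFTAL (Private Follow the Approximate Leader) with privacy parameter $\varepsilon'$ is the following online learner for convex costs $c_1,c_2,\dots$ on $\mathcal X$. With $L=\lfloor\log_2T\rfloor+1$, to each dyadic block of rounds $\{j2^i+1,\dots,(j+1)2^i\}$, $0\le i<L$, it attaches an independent noise vector $b\in\mathbb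 R^n$ with density proportional to $\exp(-\varepsilon'\|b\|_2/(2GL))$. It starts at an arbitrary $w_1\in\mathcal X$ and plays $$w_{t+1}=\operatorname*{arg\,min}_{w\in\mathcal X}\ \langle S_t,w\rangle+\frac H2\sum_{\tau\le t}\|w-w_\tau\|_2^2,\qquad H=\sqrt{\frac{n\log^{2.5}T}{\varepsilon'T}},$$ where $S_t$ is $\sum_{\tau\le t}\nabla c_\tau(w_\tau)$ plus the noise vectors of the blocks in the dyadic decomposition of $\{1,\dots,t\}$. The algorithm runs $K$ copies $\mathcal E_0,\dots,\mathcal E_{K-1}$ of PFTAL with privacy parameter $\varepsilon'$ and independent noises. In round $t$, with $v_t^k$ the point chosen by $\mathcal E_k$, it plays $x_t=\frac1K\sum_{k<K}v_t^k$, and then feeds each $\mathcal E_k$ with the linear reward $v\mapsto\langle\nabla f_t(x_t^k),v\rangle$ (that is, the cost $-\langle\nabla f_t(x_t^k),v\rangle$), where $x_t^k=\frac1K\sum_{i<k}v_t^i$. Then $x_t\in\mathcal X$ for all $t$, and: (1) Privacy. The algorithm is $(\varepsilon,0)$-differentially private: if $F,F'\in\mathcal F^T$ differ in at most one round, then $\Pr[(x_1,\dots,x_T)(F)\in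 S]\le e^{\varepsilon}\Pr[(x_1,\dots,x_T)(F')\in S]$ for every measurable $S\subseteq(\mathbb R^n)^T$. (2) Regret. For all $D$ and $\varepsilon_0$ there is a constant $C$ depending only on $n,\beta,G,D,\varepsilon_0$ such that, for all $T\ge2$, all $0<\varepsilon\le\varepsilon_0$, all $\mathcal X$ as above of diameter at most $D$, all starting points and all $f_1,\dots,f_T\in\mathcal F$, $$\mathbb E\Big[\Big(1-\frac1e\Big)\max_{x\in\mathcal X}\sum_{t=1}^Tf_t(x)-\sum_{t=1}^Tf_t(x_t)\Big]\le C\,\frac{T^{3/4}\sqrt{\log^{2.5}T}}{\varepsilon}.$$ -/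

import Mathlib

open MeasureTheory

noncomputable section

namespace DROnline

/-- Euclidean space `ℝⁿ` with the `ℓ₂` norm. -/
abbrev E (n : ℕ) := EuclideanSpace ℝ (Fin n)

/-- The coordinatewise order on `ℝⁿ`. -/
def CoordLE {n : ℕ} (x y : E n) : Prop := ∀ i, x i ≤ y i

/-- The product `∏ᵢ Iᵢ ⊆ ℝⁿ` of the sets `Iᵢ ⊆ ℝ`. -/
def box {n : ℕ} (I : Fin n → Set ℝ) : Set (E n) := {x | ∀ i, x i ∈ I i}

/-- Every factor is a bounded closed convex subset of `ℝ` containing `0`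
(so that the first query point `0` of the algorithm lies in the domain). -/
def Admissible {n : ℕ} (I : Fin n → Set ℝ) : Prop :=
  ∀ i, IsClosed (I i) ∧ Convex ℝ (I i) ∧ Bornology.IsBounded (I i) ∧ (0 : ℝ) ∈ I i

/-- The class of payoff functions: monotone DR-submodular functions `X → [0, 1]` that are
`β`-smooth and have gradients bounded by `G` on `X`, given with their gradient oracle.
Only the restrictions of `val` and `grad` to `X` matter. The gradient is that of a function on `X`,
that is, taken relative to `X`; it is determined by `val` if no factor of `X` is a point. -/
structure Payoff {n : ℕ} (X : Set (E n)) (β G : ℝ) where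
  val : E n → ℝ
  grad : E n → E n
  hasGradient : ∀ x ∈ X, HasGradientWithinAt val (grad x) X x
  mem_unit : ∀ x ∈ X, val x ∈ Set.Icc (0 : ℝ) 1
  monotone : ∀ x ∈ X, ∀ y ∈ X, CoordLE x y → val x ≤ val y
  drSubmodular : ∀ x ∈ X, ∀ y ∈ X, CoordLE x y → CoordLE (grad y) (grad x)
  smooth : ∀ x ∈ X, ∀ y ∈ X, ‖grad x - grad y‖ ≤ β * ‖x - y‖
  grad_bound : ∀ x ∈ X, ‖grad x‖ ≤ G

/-- Two input streams are neighbouring if they differ (as functions on `X`) in at most one round. -/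
def Neighboring {n T : ℕ} {X : Set (E n)} {β G : ℝ} (F F' : Fin T → Payoff X β G) : Prop :=
  ∃ t₀, ∀ t, t ≠ t₀ → ∀ x ∈ X, (F t).val x = (F' t).val x ∧ (F t).grad x = (F' t).grad x

/-- `(ε, δ)`-differential privacy of a randomized map, given by the law of its output. -/
def IsDP {𝓓 Y : Type*} [MeasurableSpace Y] (neighbor : 𝓓 → 𝓓 → Prop) (law : 𝓓 → Measure Y)
    (ε δ : ℝ) : Prop :=
  ∀ d d', neighbor d d' → ∀ S, MeasurableSet S →
    law d S ≤ ENNReal.ofReal (Real.exp ε) * law d' S + ENNReal.ofReal δ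

/-! ### Private Follow the Approximate Leader (PFTAL) -/

/-- The probability measure on `ℝⁿ` with density proportional to `exp (-‖b‖ / s)`
(uniform direction, Gamma distributed norm). -/
def radialNoise (n : ℕ) (s : ℝ) : Measure (E n) :=
  (∫⁻ b : E n, ENNReal.ofReal (Real.exp (-‖b‖ / s)))⁻¹ •
    (volume : Measure (E n)).withDensity fun b => ENNReal.ofReal (Real.exp (-‖b‖ / s))

/-- Number of levels of the aggregation tree for horizon `T`. -/
def levels (T : ℕ) : ℕ := Nat.log 2 T + 1

/-- Value of the tree node at level `i` with index `j`: the noisy sum of the vectors `g τ` over the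
dyadic block `j * 2 ^ i ≤ τ < (j + 1) * 2 ^ i`. -/
def nodeValue {n T : ℕ} (noise : Fin (levels T) → Fin T → E n) (g : ℕ → E n)
    (i : Fin (levels T)) (j : Fin T) : E n :=
  (∑ τ ∈ Finset.Ico ((j : ℕ) * 2 ^ (i : ℕ)) (((j : ℕ) + 1) * 2 ^ (i : ℕ)), g τ) + noise i j

/-- Tree based aggregation: the private version of the partial sum `∑ τ < t, g τ`. It adds up the
nodes of the dyadic decomposition of `{0, …, t - 1}`, one for each binary digit `1` of `t`. -/
def privateSum {n T : ℕ} (noise : Fin (levels T) → Fin T → E n) (g : ℕ → E n) (t : ℕ) : E n :=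
  ∑ i : Fin (levels T), ∑ j : Fin T,
    if t.testBit i = true ∧ t / 2 ^ (i : ℕ) = (j : ℕ) + 1 then nodeValue noise g i j else 0

/-- A minimizer of `φ` over `X`. -/
def argminOn {n : ℕ} (X : Set (E n)) (φ : E n → ℝ) : E n :=
  Classical.epsilon fun w => w ∈ X ∧ IsMinOn φ X w

/-- Iterates `w₀, w₁, …` of PFTAL over `X` with regularization `H`, first iterate `w₀` and given
tree noise, on convex costs with gradient oracles `costGrad τ` (the argument is where the gradient
is taken). With `S` the private version of `∑ τ ≤ t, ∇c_τ (w_τ)`, the next iterate minimizes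
`⟪S, w⟫ + H / 2 * ∑ τ ≤ t, ‖w - w_τ‖ ^ 2` over `X`. -/
def pftal {n T : ℕ} (X : Set (E n)) (H : ℝ) (w₀ : E n) (noise : Fin (levels T) → Fin T → E n)
    (costGrad : ℕ → E n → E n) : ℕ → E n
  | 0 => w₀
  | t + 1 =>
    argminOn X fun w =>
      inner ℝ (privateSum noise
          (fun τ => if _h : τ < t + 1 then
            costGrad τ (pftal X H w₀ noise costGrad τ) else 0) (t + 1)) w
        + H / 2 * ∑ τ : Fin (t + 1), ‖w - pftal X H w₀ noise costGrad τ‖ ^ 2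
  termination_by t => t
  decreasing_by
    · exact _h
    · exact τ.2

/-- Scale of the tree noise: gradients of norm at most `G`, privacy parameter `ε'`, horizon `T`. -/
def noiseScale (T : ℕ) (G ε' : ℝ) : ℝ := 2 * G * (levels T : ℝ) / ε'

/-- Regularization parameter of PFTAL in dimension `n` for costs that need not be strongly convex,
with horizon `T` and privacy parameter `ε'`. -/
def pftalReg (n T : ℕ) (ε' : ℝ) : ℝ :=
  √((n : ℝ) * Real.log T ^ (2.5 : ℝ) / (ε' * (T : ℝ)))

/-! ### The algorithm -/

/-- The number of PFTAL copies, `√(√T / log^2.5 T)` rounded up. -/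
def numLearners (T : ℕ) : ℕ := ⌈√(√(T : ℝ) / Real.log T ^ (2.5 : ℝ))⌉₊

/-- Sample space: one noise vector for each node of the tree of each of the `K` learners. -/
abbrev Noise (n T : ℕ) := Fin (numLearners T) × Fin (levels T) × Fin T → E n

/-- All the noise vectors are independent; each learner has privacy parameter `ε / K`. -/
def noiseMeasure (n T : ℕ) (G ε : ℝ) : Measure (Noise n T) :=
  Measure.pi fun _ => radialNoise n (noiseScale T G (ε / (numLearners T : ℝ)))

/-- The noise of learner `k`. -/
def learnerNoise {n T : ℕ} (ω : Noise n T) (k : ℕ) : Fin (levels T) → Fin T → E n :=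
  fun i j => if h : k < numLearners T then ω (⟨k, h⟩, i, j) else 0

/-- `direction … k t` is the direction chosen by learner `k` in round `t`. Learner `k` receives the
linear reward `v ↦ ⟪∇f_t (x_t^k), v⟫`, i.e. the linear cost with gradient `-∇f_t (x_t^k)`, where
`x_t^k` is `1 / K` times the sum of the directions of the learners before `k` in round `t`. -/
def direction {n T : ℕ} {X : Set (E n)} {β G : ℝ} (ε : ℝ) (init : ℕ → E n)
    (F : Fin T → Payoff X β G) (ω : Noise n T) (k : ℕ) : ℕ → E n :=
  pftal X (pftalReg n T (ε / (numLearners T : ℝ))) (init k) (learnerNoise ω k) fun t _ =>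
    if h : t < T then
      -(F ⟨t, h⟩).grad ((1 / (numLearners T : ℝ)) • ∑ i : Fin k, direction ε init F ω i t)
    else 0
  termination_by k
  decreasing_by exact i.2

/-- The point played in round `t`: the average of the directions of all learners. -/
def play {n T : ℕ} {X : Set (E n)} {β G : ℝ} (ε : ℝ) (init : ℕ → E n)
    (F : Fin T → Payoff X β G) (ω : Noise n T) (t : Fin T) : E n :=
  (1 / (numLearners T : ℝ)) • ∑ k : Fin (numLearners T), direction ε init F ω k t

/-- The law of the output of the algorithm, the sequence of played points. -/
def outputLaw {n T : ℕ} {X : Set (E n)} {β G : ℝ} (ε : ℝ) (init : ℕ → E n)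
    (F : Fin T → Payoff X β G) : Measure (Fin T → E n) :=
  (noiseMeasure n T G ε).map (play ε init F)

/-- The `(1 - 1/e)`-regret of a sequence of points. -/
def regret {n T : ℕ} {X : Set (E n)} {β G : ℝ} (F : Fin T → Payoff X β G) (x : Fin T → E n) : ℝ :=
  (1 - 1 / Real.exp 1) * sSup ((fun y => ∑ t, (F t).val y) '' X) - ∑ t, (F t).val (x t)

end DROnline

end

noncomputable section

namespace DROnline

/-! ### Boxes -/

/-! Privacy is a coupling argument. While the two runs on neighbouring streams agree, learner `k`
sees different gradients only in round `t₀`. Translating the noise of the blocks that contain `t₀`,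
one per level, by the difference of the two gradients restores every relevant node of the tree,
hence every iterate. The difference for learner `k` is taken at a query point that depends only on
the noise of the learners before `k`, so the translation, though it depends on the noise, is
triangular and preserves Lebesgue measure (`measurePreserving_triangular`). For `K` learners with
`L` levels its total length is at most `2GLK`, and the noise has scale `2GLK / ε`, so the density
changes by at most a factor `exp ε`.

For the regret, monotonicity makes the top corner `u` of the box optimal for all payoffs at once, so
the comparator is fixed. Within a round the partial averages perform a Frank-Wolfe ascent, whose `(1
- 1/e)`-gap is controlled by the average of the learners' linear regrets against `u` plus `O(1 / K)`
(`frankWolfe_gap`). Since the box may contain negative coordinates, DR-submodularity bounds the gap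
from the positive part `x⁺` and not from `x`. The deficit `f(x⁺) - f(x)` obeys the same error bound,
at the price of a factor `2`.

The linear regret of a learner is bounded for every realization of the noise by comparison with a
noiseless leader (`pftal_regret`), so that only the expected norm of the tree noise is needed, and
no independence of noise and gradients. With `K` about `T^(1/4) / log^(5/4) T`, the discretization
error `T / K` sets the rate; the other terms have a smaller power of `T`. -/

theorem convex_box {n : ℕ} {I : Fin n → Set ℝ} (hI : Admissible I) : Convex ℝ (box I) := by
  intro x hx y hy a b ha hb hab i
  exact (hI i).2.1 (hx i) (hy i) ha hb hab

theorem zero_mem_box {n : ℕ} {I : Fin n → Set ℝ} (hI : Admissible I) : (0 : E n) ∈ box I :=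
  fun i => (hI i).2.2.2

theorem isCompact_box {n : ℕ} {I : Fin n → Set ℝ} (hI : Admissible I) : IsCompact (box I) := by
  have h : IsCompact (Set.pi Set.univ I) :=
    isCompact_univ_pi fun i => Metric.isCompact_of_isClosed_isBounded (hI i).1 (hI i).2.2.1
  have h2 : box I = (EuclideanSpace.equiv (Fin n) ℝ).toHomeomorph ⁻¹' (Set.pi Set.univ I) := by
    ext x
    simp [box, Set.mem_pi]
  rw [h2]
  exact (EuclideanSpace.equiv (Fin n) ℝ).toHomeomorph.isCompact_preimage.2 h

/-- The greatest element of a box. -/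
def topCorner {n : ℕ} (I : Fin n → Set ℝ) : E n := WithLp.toLp 2 fun i => sSup (I i)

theorem topCorner_mem {n : ℕ} {I : Fin n → Set ℝ} (hI : Admissible I) : topCorner I ∈ box I :=
  fun i => (Metric.isCompact_of_isClosed_isBounded (hI i).1 (hI i).2.2.1).sSup_mem
    ⟨0, (hI i).2.2.2⟩

theorem le_topCorner {n : ℕ} {I : Fin n → Set ℝ} (hI : Admissible I) {x : E n} (hx : x ∈ box I) :
    CoordLE x (topCorner I) :=
  fun i => le_csSup (hI i).2.2.1.bddAbove (hx i)

theorem dist_le_diam_box {n : ℕ} {I : Fin n → Set ℝ} (hI : Admissible I) {x y : E n}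
    (hx : x ∈ box I) (hy : y ∈ box I) : ‖x - y‖ ≤ Metric.diam (box I) := by
  rw [← dist_eq_norm]
  exact Metric.dist_le_diam_of_mem (isCompact_box hI).isBounded hx hy

theorem norm_le_diam_box {n : ℕ} {I : Fin n → Set ℝ} (hI : Admissible I) {x : E n}
    (hx : x ∈ box I) : ‖x‖ ≤ Metric.diam (box I) := by
  simpa using dist_le_diam_box hI hx (zero_mem_box hI)

/-- A partial average of points of a convex set containing `0` lies in the set. -/
theorem partialAverage_mem {n : ℕ} {X : Set (E n)} (hX : Convex ℝ X) (h0 : (0 : E n) ∈ X)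
    {K k : ℕ} (hk : k ≤ K) {v : ℕ → E n} (hv : ∀ i < k, v i ∈ X) :
    (1 / (K : ℝ)) • ∑ i ∈ Finset.range k, v i ∈ X := by
  rcases Nat.eq_zero_or_pos k with rfl | hk0
  · simpa using h0
  have hk0' : (0 : ℝ) < k := by exact_mod_cast hk0
  have hK0' : (0 : ℝ) < K := by exact_mod_cast hk0.trans_le hk
  have h1 : (1 / (k : ℝ)) • ∑ i ∈ Finset.range k, v i ∈ X := by
    rw [Finset.smul_sum]
    refine hX.sum_mem (fun i _ => by positivity) ?_ fun i hi => hv i (Finset.mem_range.1 hi)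
    simp [hk0'.ne']
  have h2 := hX.smul_mem_of_zero_mem h0 h1 (t := (k : ℝ) / K)
    ⟨by positivity, (div_le_one hK0').2 (by exact_mod_cast hk)⟩
  rw [smul_smul] at h2
  convert h2 using 2
  field_simp

/-! ### Minimizers of quadratics -/

theorem argminOn_spec {n : ℕ} {X : Set (E n)} (hX : IsCompact X) (hne : X.Nonempty)
    {φ : E n → ℝ} (hφ : Continuous φ) : argminOn X φ ∈ X ∧ IsMinOn φ X (argminOn X φ) := by
  obtain ⟨w, hw, hmin⟩ := hX.exists_isMinOn hne hφ.continuousOn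
  exact Classical.epsilon_spec (p := fun w => w ∈ X ∧ IsMinOn φ X w) ⟨w, hw, hmin⟩

/-- First order optimality condition for the sum of a linear form and squared distances. -/
theorem variationalInequality {n : ℕ} {X : Set (E n)} (hX : Convex ℝ X) {H : ℝ} {s w : E n}
    {ι : Type*} {A : Finset ι} {p : ι → E n} (hw : w ∈ X)
    (hmin : IsMinOn (fun v => inner ℝ s v + H / 2 * ∑ τ ∈ A, ‖v - p τ‖ ^ 2) X w)
    {y : E n} (hy : y ∈ X) :
    0 ≤ inner ℝ (s - H • ∑ τ ∈ A, p τ + (H * A.card) • w) (y - w) := by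
  set a := inner ℝ (s - H • ∑ τ ∈ A, p τ + (H * A.card) • w) (y - w) with ha
  set b := H / 2 * A.card * ‖y - w‖ ^ 2 with hb
  -- `r * (a + r * b)` is the increment of the objective from `w` to `w + r • (y - w)`; `a` is the
  -- directional derivative.
  have key : ∀ r : ℝ, 0 < r → r ≤ 1 → 0 ≤ a + r * b := by
    intro r hr0 hr1
    have hmem : w + r • (y - w) ∈ X := hX.add_smul_sub_mem hw hy ⟨hr0.le, hr1⟩
    have h1 := hmin hmem
    simp only [Set.mem_ofPred_eq] at h1
    have h2 : ∀ τ, ‖w + r • (y - w) - p τ‖ ^ 2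
        = ‖w - p τ‖ ^ 2 + (2 * r * inner ℝ (w - p τ) (y - w) + r ^ 2 * ‖y - w‖ ^ 2) := by
      intro τ
      rw [show w + r • (y - w) - p τ = (w - p τ) + r • (y - w) by abel, norm_add_sq_real,
        inner_smul_right, norm_smul, mul_pow, Real.norm_eq_abs, sq_abs]
      ring
    simp only [h2] at h1
    rw [Finset.sum_add_distrib, Finset.sum_add_distrib, ← Finset.mul_sum, Finset.sum_const,
      ← sum_inner, Finset.sum_sub_distrib, Finset.sum_const, inner_add_right,
      inner_smul_right] at h1
    have h3 : r * (a + r * b) = r * inner ℝ s (y - w)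
        + H / 2 * (2 * r * inner ℝ (A.card • w - ∑ τ ∈ A, p τ) (y - w)
          + A.card • (r ^ 2 * ‖y - w‖ ^ 2)) := by
      rw [ha, hb, inner_add_left, inner_sub_left, inner_sub_left, inner_smul_left,
        inner_smul_left, ← Nat.cast_smul_eq_nsmul ℝ, inner_smul_left]
      simp
      ring
    have h4 : 0 ≤ r * (a + r * b) := by rw [h3]; linarith
    exact nonneg_of_mul_nonneg_right h4 hr0
  by_contra hlt
  push Not at hlt
  -- This step length satisfies `r * |b| ≤ -a / 2`, so `a + r * b ≤ a / 2 < 0`.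
  have hr : 0 < -a / (2 * (|b| + -a)) := by
    have := abs_nonneg b
    apply div_pos <;> linarith
  have hd : 0 < 2 * (|b| + -a) := by have := abs_nonneg b; linarith
  have h := key _ hr (by rw [div_le_one hd]; have := abs_nonneg b; linarith)
  have h5 : -a / (2 * (|b| + -a)) * b ≤ -a / (2 * (|b| + -a)) * |b| :=
    mul_le_mul_of_nonneg_left (le_abs_self b) hr.le
  have h6 : -a / (2 * (|b| + -a)) * |b| ≤ -a / 2 := by
    rw [div_mul_eq_mul_div, div_le_div_iff₀ hd two_pos]
    nlinarith [abs_nonneg b]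
  linarith

/-- Solutions of strongly monotone variational inequalities depend Lipschitz continuously on the
data. -/
theorem norm_sub_le_of_variationalInequality {n : ℕ} {c : ℝ} {z z' w w' : E n}
    (h : 0 ≤ inner ℝ (z + c • w) (w' - w)) (h' : 0 ≤ inner ℝ (z' + c • w') (w - w')) :
    c * ‖w - w'‖ ≤ ‖z - z'‖ := by
  have h1 : c * ‖w - w'‖ ^ 2 ≤ inner ℝ (z - z') (w' - w) := by
    have : inner ℝ (z + c • w) (w' - w) + inner ℝ (z' + c • w') (w - w')
        = inner ℝ (z - z') (w' - w) - c * ‖w - w'‖ ^ 2 := by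
      rw [← real_inner_self_eq_norm_sq, ← neg_sub w w']
      simp only [inner_add_left, inner_sub_left, inner_neg_right, inner_sub_right,
        inner_smul_left]
      simp
      ring
    linarith
  have h2 := real_inner_le_norm (z - z') (w' - w)
  rw [norm_sub_rev w' w] at h2
  rcases (norm_nonneg (w - w')).eq_or_lt with h0 | h0
  · rw [← h0]; simp
  · have : (c * ‖w - w'‖) * ‖w - w'‖ ≤ ‖z - z'‖ * ‖w - w'‖ := by nlinarith
    exact le_of_mul_le_mul_right this h0

/-! ### Tree aggregation -/

/-- A block is used at time `t` only if it ends by then. Comparing whole node values, and not noise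
and gradients separately, is what lets a shift of the noise cancel a change of the gradients. -/
theorem privateSum_congr {n T : ℕ} {noise noise' : Fin (levels T) → Fin T → E n} {g g' : ℕ → E n}
    {t : ℕ} (h : ∀ (i : Fin (levels T)) (j : Fin T), ((j : ℕ) + 1) * 2 ^ (i : ℕ) ≤ t →
      nodeValue noise g i j = nodeValue noise' g' i j) :
    privateSum noise g t = privateSum noise' g' t := by
  unfold privateSum
  refine Finset.sum_congr rfl fun i _ => Finset.sum_congr rfl fun j _ => ?_
  split_ifs with hc
  · refine h i j ?_
    rw [← hc.2]
    exact Nat.div_mul_le_self _ _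
  · rfl

/-- The iterates of PFTAL on linear costs minimize a quadratic. -/
theorem pftal_succ {n T : ℕ} (X : Set (E n)) (H : ℝ) (w₀ : E n)
    (noise : Fin (levels T) → Fin T → E n) (g : ℕ → E n) (t : ℕ) :
    pftal X H w₀ noise (fun τ _ => g τ) (t + 1) = argminOn X fun w =>
      inner ℝ (privateSum noise g (t + 1)) w + H / 2 * ∑ τ ∈ Finset.range (t + 1),
        ‖w - pftal X H w₀ noise (fun τ _ => g τ) τ‖ ^ 2 := by
  -- The truncation in the recursion is invisible, because all blocks in use end by `t + 1`.
  have h : privateSum noise (fun τ => if _h : τ < t + 1 then g τ else 0) (t + 1)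
      = privateSum noise g (t + 1) := by
    refine privateSum_congr fun i j hij => ?_
    unfold nodeValue
    congr 1
    refine Finset.sum_congr rfl fun τ hτ => ?_
    exact dif_pos ((Finset.mem_Ico.1 hτ).2.trans_le hij)
  rw [pftal]
  simp only [h, Finset.sum_range]

theorem pftal_zero {n T : ℕ} (X : Set (E n)) (H : ℝ) (w₀ : E n)
    (noise : Fin (levels T) → Fin T → E n) (c : ℕ → E n → E n) :
    pftal X H w₀ noise c 0 = w₀ := by
  rw [pftal]

theorem pftal_succ_spec {n T : ℕ} {X : Set (E n)} (hX : IsCompact X) (hne : X.Nonempty) (H : ℝ)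
    (w₀ : E n) (noise : Fin (levels T) → Fin T → E n) (g : ℕ → E n) (t : ℕ) :
    pftal X H w₀ noise (fun τ _ => g τ) (t + 1) ∈ X ∧
    IsMinOn (fun w => inner ℝ (privateSum noise g (t + 1)) w + H / 2 *
      ∑ τ ∈ Finset.range (t + 1), ‖w - pftal X H w₀ noise (fun τ _ => g τ) τ‖ ^ 2) X
      (pftal X H w₀ noise (fun τ _ => g τ) (t + 1)) := by
  rw [pftal_succ]
  exact argminOn_spec hX hne (by fun_prop)

theorem pftal_mem {n T : ℕ} {X : Set (E n)} (hX : IsCompact X) (H : ℝ) {w₀ : E n} (hw₀ : w₀ ∈ X)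
    (noise : Fin (levels T) → Fin T → E n) (g : ℕ → E n) (t : ℕ) :
    pftal X H w₀ noise (fun τ _ => g τ) t ∈ X := by
  cases t with
  | zero => rwa [pftal_zero]
  | succ t => exact (pftal_succ_spec hX ⟨w₀, hw₀⟩ H w₀ noise g t).1

/-- PFTAL on linear costs depends on the noise and the costs only through the tree nodes. -/
theorem pftal_congr {n T : ℕ} (X : Set (E n)) (H : ℝ) (w₀ : E n)
    {noise noise' : Fin (levels T) → Fin T → E n} {g g' : ℕ → E n} {m : ℕ}
    (h : ∀ (i : Fin (levels T)) (j : Fin T), ((j : ℕ) + 1) * 2 ^ (i : ℕ) < m →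
      nodeValue noise g i j = nodeValue noise' g' i j) {t : ℕ} (ht : t < m) :
    pftal X H w₀ noise (fun τ _ => g τ) t = pftal X H w₀ noise' (fun τ _ => g' τ) t := by
  induction t using Nat.strong_induction_on with
  | _ t ih =>
    cases t with
    | zero => rw [pftal_zero, pftal_zero]
    | succ t =>
      rw [pftal_succ, pftal_succ, privateSum_congr (noise' := noise') (g' := g')
        fun i j hij => h i j (hij.trans_lt ht)]
      congr 1
      funext w
      congr 2
      refine Finset.sum_congr rfl fun τ hτ => ?_
      have hτ' := Finset.mem_range.1 hτ
      rw [ih τ hτ' (by omega)]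

/-! ### The learners -/

section Learners

variable {n T : ℕ} {X : Set (E n)} {β G : ℝ} (ε : ℝ) (init : ℕ → E n)
    (F : Fin T → Payoff X β G) (ω : Noise n T)

/-- The point at which the payoff gradient for learner `k` is queried in round `t`. -/
def queryPoint (k t : ℕ) : E n :=
  (1 / (numLearners T : ℝ)) • ∑ i ∈ Finset.range k, direction ε init F ω i t

/-- The gradient of the linear cost that learner `k` receives in round `t`. -/
def costVector (k t : ℕ) : E n :=
  if h : t < T then -(F ⟨t, h⟩).grad (queryPoint ε init F ω k t) else 0

theorem direction_eq (k : ℕ) :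
    direction ε init F ω k = pftal X (pftalReg n T (ε / (numLearners T : ℝ))) (init k)
      (learnerNoise ω k) fun t _ => costVector ε init F ω k t := by
  rw [direction]
  simp only [costVector, queryPoint, Finset.sum_range]

theorem play_eq (t : Fin T) :
    play ε init F ω t = queryPoint ε init F ω (numLearners T) t := by
  simp only [play, queryPoint, Finset.sum_range]

end Learners

section LearnersInBox

variable {n T : ℕ} {I : Fin n → Set ℝ} {β G : ℝ} {ε : ℝ} {init : ℕ → E n}

theorem direction_mem (hI : Admissible I) (hinit : ∀ k, init k ∈ box I)
    (F : Fin T → Payoff (box I) β G) (ω : Noise n T) (k t : ℕ) :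
    direction ε init F ω k t ∈ box I := by
  rw [direction_eq]
  exact pftal_mem (isCompact_box hI) _ (hinit k) _ _ _

theorem queryPoint_mem (hI : Admissible I) (hinit : ∀ k, init k ∈ box I)
    (F : Fin T → Payoff (box I) β G) (ω : Noise n T) {k : ℕ} (hk : k ≤ numLearners T) (t : ℕ) :
    queryPoint ε init F ω k t ∈ box I :=
  partialAverage_mem (convex_box hI) (zero_mem_box hI) hk fun i _ =>
    direction_mem hI hinit F ω i t

theorem norm_costVector_le (hI : Admissible I) (hinit : ∀ k, init k ∈ box I) (hG : 0 ≤ G)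
    (F : Fin T → Payoff (box I) β G) (ω : Noise n T) {k : ℕ} (hk : k ≤ numLearners T) (t : ℕ) :
    ‖costVector ε init F ω k t‖ ≤ G := by
  unfold costVector
  split_ifs with h
  · rw [norm_neg]
    exact (F _).grad_bound _ (queryPoint_mem hI hinit F ω hk t)
  · simpa using hG

end LearnersInBox

/-! ### Continuity of the iterates in the noise -/

theorem continuous_privateSum {Ω : Type*} [TopologicalSpace Ω] {n T : ℕ}
    {noise : Ω → Fin (levels T) → Fin T → E n} {g : Ω → ℕ → E n}
    (hnoise : ∀ i j, Continuous fun ω => noise ω i j) (hg : ∀ t, Continuous fun ω => g ω t)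
    (t : ℕ) : Continuous fun ω => privateSum (noise ω) (g ω) t := by
  unfold privateSum nodeValue
  refine continuous_finsetSum _ fun i _ => continuous_finsetSum _ fun j _ => ?_
  split_ifs
  · exact (continuous_finsetSum _ fun τ _ => hg τ).add (hnoise i j)
  · exact continuous_const

/-- The iterate solves a variational inequality of modulus `H * (t + 1)`, hence is a Lipschitz
function of the noisy sum and the earlier iterates. This is the source of all measurability below.
-/
theorem continuous_pftal {Ω : Type*} [TopologicalSpace Ω] {n T : ℕ} {X : Set (E n)}
    (hX : IsCompact X) (hXc : Convex ℝ X) {H : ℝ} (hH : 0 < H) {w₀ : E n} (hw₀ : w₀ ∈ X)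
    {noise : Ω → Fin (levels T) → Fin T → E n} {g : Ω → ℕ → E n}
    (hnoise : ∀ i j, Continuous fun ω => noise ω i j) (hg : ∀ t, Continuous fun ω => g ω t)
    (t : ℕ) : Continuous fun ω => pftal X H w₀ (noise ω) (fun τ _ => g ω τ) t := by
  induction t using Nat.strong_induction_on with
  | _ t ih =>
    cases t with
    | zero => simp only [pftal_zero]; exact continuous_const
    | succ t =>
      set w := fun (t : ℕ) (ω : Ω) => pftal X H w₀ (noise ω) (fun τ _ => g ω τ) t with hw
      set z := fun ω => privateSum (noise ω) (g ω) (t + 1)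
        - H • ∑ τ ∈ Finset.range (t + 1), w τ ω with hz
      have hzc : Continuous z := by
        refine (continuous_privateSum hnoise hg _).sub (Continuous.const_smul ?_ H)
        exact continuous_finsetSum _ fun τ hτ => ih τ (Finset.mem_range.1 hτ)
      have hvi : ∀ ω, ∀ y ∈ X, 0 ≤ inner ℝ (z ω + (H * (t + 1 : ℕ)) • w (t + 1) ω)
          (y - w (t + 1) ω) := by
        intro ω y hy
        have h := pftal_succ_spec hX ⟨w₀, hw₀⟩ H w₀ (noise ω) (g ω) t
        have h2 := variationalInequality hXc h.1 h.2 hy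
        rwa [Finset.card_range] at h2
      have hc : 0 < H * (t + 1 : ℕ) := by positivity
      refine continuous_iff_continuousAt.2 fun ω₀ => ?_
      have hlim : Filter.Tendsto (fun ω => (H * (t + 1 : ℕ))⁻¹ * ‖z ω - z ω₀‖) (nhds ω₀)
          (nhds 0) := by
        have : Continuous fun ω => (H * (t + 1 : ℕ))⁻¹ * ‖z ω - z ω₀‖ := by fun_prop
        simpa using this.tendsto ω₀
      refine tendsto_iff_norm_sub_tendsto_zero.2
        (squeeze_zero (fun _ => norm_nonneg _) (fun ω => ?_) hlim)
      have hm : ∀ ω, w (t + 1) ω ∈ X := fun ω => pftal_mem hX H hw₀ _ _ _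
      have := norm_sub_le_of_variationalInequality (hvi ω _ (hm ω₀)) (hvi ω₀ _ (hm ω))
      rwa [inv_mul_eq_div, le_div_iff₀ hc, mul_comm]

theorem Payoff.continuousOn_grad {n : ℕ} {X : Set (E n)} {β G : ℝ} (f : Payoff X β G) :
    ContinuousOn f.grad X := by
  intro x hx
  have hlim : Filter.Tendsto (fun y => β * ‖y - x‖) (nhdsWithin x X) (nhds 0) := by
    have : Continuous fun y => β * ‖y - x‖ := by fun_prop
    simpa using (this.tendsto x).mono_left nhdsWithin_le_nhds
  refine tendsto_iff_norm_sub_tendsto_zero.2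
    (squeeze_zero' (Filter.Eventually.of_forall fun _ => norm_nonneg _) ?_ hlim)
  filter_upwards [self_mem_nhdsWithin] with y hy using f.smooth y hy x hx

theorem Payoff.continuousOn_val {n : ℕ} {X : Set (E n)} {β G : ℝ} (f : Payoff X β G) :
    ContinuousOn f.val X :=
  fun x hx => (f.hasGradient x hx).continuousWithinAt

section Learners

variable {n T : ℕ} {I : Fin n → Set ℝ} {β G : ℝ} {ε : ℝ} {init : ℕ → E n}

theorem continuous_learnerNoise (k : ℕ) (i : Fin (levels T)) (j : Fin T) :
    Continuous fun ω : Noise n T => learnerNoise ω k i j := by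
  unfold learnerNoise
  split_ifs
  · exact continuous_apply _
  · exact continuous_const

theorem continuous_direction (hI : Admissible I) (hinit : ∀ k, init k ∈ box I)
    (hH : 0 < pftalReg n T (ε / (numLearners T : ℝ))) (F : Fin T → Payoff (box I) β G)
    {k : ℕ} (hk : k ≤ numLearners T) (t : ℕ) :
    Continuous fun ω => direction ε init F ω k t := by
  induction k using Nat.strong_induction_on generalizing t with
  | _ k ih =>
    simp only [direction_eq]
    refine continuous_pftal (isCompact_box hI) (convex_box hI) hH (hinit k)
      (continuous_learnerNoise k) (fun t => ?_) t
    unfold costVector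
    split_ifs with h
    · refine Continuous.neg ?_
      refine (F ⟨t, h⟩).continuousOn_grad.comp_continuous ?_
        fun ω => queryPoint_mem hI hinit F ω hk t
      have h : Continuous fun ω => ∑ i ∈ Finset.range k, direction ε init F ω i t :=
        continuous_finsetSum _ fun i hi =>
          have := Finset.mem_range.1 hi
          ih i this (by omega) t
      exact h.const_smul (1 / (numLearners T : ℝ))
    · exact continuous_const

theorem pftalReg_pos {n T : ℕ} (hn : 0 < n) (hT : 2 ≤ T) {ε : ℝ} (hε : 0 < ε) :
    0 < pftalReg n T ε := by
  have h1 : 0 < Real.log T := Real.log_pos (by exact_mod_cast hT)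
  have h2 : (0 : ℝ) < T := by positivity
  have h3 : (0 : ℝ) < n := by exact_mod_cast hn
  unfold pftalReg
  positivity

theorem numLearners_pos {T : ℕ} (hT : 2 ≤ T) : 0 < numLearners T := by
  have h1 : 0 < Real.log T := Real.log_pos (by exact_mod_cast hT)
  have h2 : (0 : ℝ) < T := by positivity
  exact Nat.ceil_pos.2 (by positivity)

theorem measurable_direction (hT : 2 ≤ T) (hε : 0 < ε) (hI : Admissible I)
    (hinit : ∀ k, init k ∈ box I) (F : Fin T → Payoff (box I) β G)
    {k : ℕ} (hk : k ≤ numLearners T) (t : ℕ) :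
    Measurable fun ω => direction ε init F ω k t := by
  -- In dimension `0` the regularization is `0` and continuity is not available, but the codomain is
  -- a point.
  rcases Nat.eq_zero_or_pos n with rfl | hn
  · exact measurable_of_subsingleton_codomain _
  · have hK : (0 : ℝ) < numLearners T := by exact_mod_cast numLearners_pos hT
    exact (continuous_direction hI hinit (pftalReg_pos hn hT (div_pos hε hK)) F hk t).measurable

theorem measurable_queryPoint (hT : 2 ≤ T) (hε : 0 < ε) (hI : Admissible I)
    (hinit : ∀ k, init k ∈ box I) (F : Fin T → Payoff (box I) β G)
    {k : ℕ} (hk : k ≤ numLearners T) (t : ℕ) :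
    Measurable fun ω => queryPoint ε init F ω k t := by
  have h : Measurable fun ω => ∑ i ∈ Finset.range k, direction ε init F ω i t :=
    Finset.measurable_sum _ fun i hi =>
      have := Finset.mem_range.1 hi
      measurable_direction hT hε hI hinit F (by omega) t
  exact h.const_smul (1 / (numLearners T : ℝ))

theorem measurable_grad_queryPoint (hT : 2 ≤ T) (hε : 0 < ε) (hI : Admissible I)
    (hinit : ∀ k, init k ∈ box I) (F : Fin T → Payoff (box I) β G)
    {k : ℕ} (hk : k ≤ numLearners T) (t : ℕ) (f : Payoff (box I) β G) :
    Measurable fun ω => f.grad (queryPoint ε init F ω k t) := by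
  -- Off the box the gradient oracle is arbitrary, so only its restriction is known to be
  -- measurable.
  have h : Measurable ((box I).domRestrict f.grad) :=
    (continuousOn_iff_continuous_domRestrict.1 f.continuousOn_grad).measurable
  exact h.comp ((measurable_queryPoint hT hε hI hinit F hk t).subtype_mk
    (h := fun ω => queryPoint_mem hI hinit F ω hk t))

theorem measurable_val_play (hT : 2 ≤ T) (hε : 0 < ε) (hI : Admissible I)
    (hinit : ∀ k, init k ∈ box I) (F : Fin T → Payoff (box I) β G)
    (t : Fin T) (f : Payoff (box I) β G) :
    Measurable fun ω => f.val (play ε init F ω t) := by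
  simp only [play_eq]
  have h : Measurable ((box I).domRestrict f.val) :=
    (continuousOn_iff_continuous_domRestrict.1 f.continuousOn_val).measurable
  exact h.comp ((measurable_queryPoint hT hε hI hinit F le_rfl t).subtype_mk
    (h := fun ω => queryPoint_mem hI hinit F ω le_rfl t))

theorem measurable_play (hT : 2 ≤ T) (hε : 0 < ε) (hI : Admissible I)
    (hinit : ∀ k, init k ∈ box I) (F : Fin T → Payoff (box I) β G) :
    Measurable (play ε init F) := by
  refine measurable_pi_lambda _ fun t => ?_
  simp only [play_eq]
  exact measurable_queryPoint hT hε hI hinit F le_rfl t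

end Learners

/-! ### Radial noise -/

/-- In polar coordinates this is a Gamma integral with exponent `n - 1 + p`. Dimension `0` has no
polar coordinates, but the space is compact. -/
theorem integrable_norm_pow_mul_exp (n : ℕ) (p : ℕ) {s : ℝ} (hs : 0 < s) :
    Integrable (fun b : E n => ‖b‖ ^ p * Real.exp (-‖b‖ / s)) := by
  rcases Nat.eq_zero_or_pos n with rfl | hn
  · have hc : Continuous fun b : E 0 => ‖b‖ ^ p * Real.exp (-‖b‖ / s) := by fun_prop
    exact hc.integrable_of_hasCompactSupport (HasCompactSupport.of_compactSpace _)
  · have : Nonempty (Fin n) := ⟨⟨0, hn⟩⟩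
    rw [integrable_fun_norm_addHaar volume (f := fun r : ℝ => r ^ p * Real.exp (-r / s))]
    have h := integrableOn_rpow_mul_exp_neg_mul_rpow (p := 1) (s := ((n - 1 + p : ℕ) : ℝ))
      (b := s⁻¹) (by have : (0:ℝ) ≤ ((n - 1 + p : ℕ) : ℝ) := by positivity
                     linarith) one_pos (by positivity)
    refine h.congr_fun (fun r hr => ?_) measurableSet_Ioi
    have hr' : (0 : ℝ) < r := hr
    simp only [finrank_euclideanSpace, Fintype.card_fin, smul_eq_mul, Real.rpow_natCast,
      Real.rpow_one]
    rw [pow_add, mul_assoc]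
    congr 3
    field_simp

theorem integrable_exp_neg_norm (n : ℕ) {s : ℝ} (hs : 0 < s) :
    Integrable (fun b : E n => Real.exp (-‖b‖ / s)) := by
  simpa using integrable_norm_pow_mul_exp n 0 hs

/-- The normalizing constant of the radial noise. -/
def radialMass (n : ℕ) (s : ℝ) : ℝ := ∫ b : E n, Real.exp (-‖b‖ / s)

theorem radialMass_pos (n : ℕ) {s : ℝ} (hs : 0 < s) : 0 < radialMass n s :=
  integral_exp_pos (integrable_exp_neg_norm n hs)

/-- The density of the radial noise. -/
def radialDensity (n : ℕ) (s : ℝ) (b : E n) : ℝ := (radialMass n s)⁻¹ * Real.exp (-‖b‖ / s)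

theorem radialDensity_pos {n : ℕ} {s : ℝ} (hs : 0 < s) (b : E n) : 0 < radialDensity n s b :=
  mul_pos (inv_pos.2 (radialMass_pos n hs)) (Real.exp_pos _)

theorem integrable_radialDensity (n : ℕ) {s : ℝ} (hs : 0 < s) :
    Integrable (radialDensity n s) :=
  (integrable_exp_neg_norm n hs).const_mul _

theorem measurable_radialDensity (n : ℕ) (s : ℝ) : Measurable (radialDensity n s) := by
  unfold radialDensity
  fun_prop

theorem radialNoise_eq (n : ℕ) {s : ℝ} (hs : 0 < s) :
    radialNoise n s = volume.withDensity fun b => ENNReal.ofReal (radialDensity n s b) := by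
  have h1 : (∫⁻ b : E n, ENNReal.ofReal (Real.exp (-‖b‖ / s))) = ENNReal.ofReal (radialMass n s) :=
    (ofReal_integral_eq_lintegral_ofReal (integrable_exp_neg_norm n hs)
      (Filter.Eventually.of_forall fun _ => (Real.exp_pos _).le)).symm
  unfold radialNoise
  rw [h1, ← ENNReal.ofReal_inv_of_pos (radialMass_pos n hs), ← withDensity_smul _ (by fun_prop)]
  congr 1
  funext b
  rw [Pi.smul_apply, smul_eq_mul, radialDensity,
    ENNReal.ofReal_mul (inv_pos.2 (radialMass_pos n hs)).le]

theorem isProbabilityMeasure_radialNoise (n : ℕ) {s : ℝ} (hs : 0 < s) :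
    IsProbabilityMeasure (radialNoise n s) := by
  constructor
  rw [radialNoise_eq n hs, withDensity_apply _ MeasurableSet.univ, Measure.restrict_univ,
    ← ofReal_integral_eq_lintegral_ofReal (integrable_radialDensity n hs)
      (Filter.Eventually.of_forall fun b => (radialDensity_pos hs b).le)]
  unfold radialDensity
  rw [integral_const_mul, ← radialMass, inv_mul_cancel₀ (radialMass_pos n hs).ne',
    ENNReal.ofReal_one]

theorem integrable_norm_radialNoise (n : ℕ) {s : ℝ} (hs : 0 < s) :
    Integrable (fun b : E n => ‖b‖) (radialNoise n s) := by
  rw [radialNoise_eq n hs, integrable_withDensity_iff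
    (measurable_radialDensity n s).ennreal_ofReal (Filter.Eventually.of_forall fun _ => by simp)]
  refine ((integrable_norm_pow_mul_exp n 1 hs).const_mul (radialMass n s)⁻¹).congr
    (Filter.Eventually.of_forall fun b => ?_)
  simp only
  rw [ENNReal.toReal_ofReal (radialDensity_pos hs b).le, radialDensity]
  ring

/-- The expected norm of the radial noise of scale `1`. -/
def radialMean (n : ℕ) : ℝ := ∫ b : E n, ‖b‖ ∂(radialNoise n 1)

theorem radialMean_nonneg (n : ℕ) : 0 ≤ radialMean n := integral_nonneg fun _ => norm_nonneg _

theorem integral_norm_radialNoise_eq (n : ℕ) {s : ℝ} (hs : 0 < s) :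
    ∫ b : E n, ‖b‖ ∂(radialNoise n s) =
      (radialMass n s)⁻¹ * ∫ b : E n, ‖b‖ * Real.exp (-‖b‖ / s) := by
  rw [radialNoise_eq n hs, integral_withDensity_eq_integral_toReal_smul
    (measurable_radialDensity n s).ennreal_ofReal (Filter.Eventually.of_forall fun _ => by simp),
    ← integral_const_mul]
  congr 1
  funext b
  rw [ENNReal.toReal_ofReal (radialDensity_pos hs b).le, radialDensity, smul_eq_mul]
  ring

/-- Rescaling by `s` multiplies the normalizing constant by `s ^ n` and the first moment by `s ^ (n
+ 1)`. -/
theorem integral_norm_radialNoise (n : ℕ) {s : ℝ} (hs : 0 < s) :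
    ∫ b : E n, ‖b‖ ∂(radialNoise n s) = s * radialMean n := by
  have hn : ∀ b : E n, ‖s⁻¹ • b‖ = ‖b‖ / s := fun b => by
    rw [norm_smul, Real.norm_of_nonneg (inv_pos.2 hs).le, inv_mul_eq_div]
  have hc : |((s⁻¹) ^ n)⁻¹| = s ^ n := by
    rw [inv_pow, inv_inv, abs_of_pos (by positivity)]
  have h1 : radialMass n s = s ^ n * radialMass n 1 := by
    have h := Measure.integral_comp_smul (volume : Measure (E n))
      (fun b => Real.exp (-‖b‖ / 1)) s⁻¹
    simp only [hn, finrank_euclideanSpace, Fintype.card_fin, hc, smul_eq_mul] at h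
    unfold radialMass
    rw [← h]
    congr 1
    funext b
    congr 1
    ring
  have h2 : (∫ b : E n, ‖b‖ * Real.exp (-‖b‖ / s))
      = s * (s ^ n * ∫ b : E n, ‖b‖ * Real.exp (-‖b‖ / 1)) := by
    have h := Measure.integral_comp_smul (volume : Measure (E n))
      (fun b => ‖b‖ * Real.exp (-‖b‖ / 1)) s⁻¹
    simp only [hn, finrank_euclideanSpace, Fintype.card_fin, hc, smul_eq_mul] at h
    rw [← h, ← integral_const_mul]
    congr 1
    funext b
    rw [← mul_assoc, mul_div_cancel₀ _ hs.ne']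
    congr 2
    ring
  rw [radialMean, integral_norm_radialNoise_eq n hs, integral_norm_radialNoise_eq n one_pos, h1,
    h2]
  have := (radialMass_pos n one_pos).ne'
  field_simp

/-! ### Product measures -/

/-- A finite product of measures with densities has the product density. -/
theorem pi_withDensity_ofReal {ι α : Type*} [Fintype ι] [MeasurableSpace α] (ν : Measure α)
    [SigmaFinite ν] {p : α → ℝ} (hp0 : ∀ a, 0 ≤ p a) (hpi : Integrable p ν) :
    (Measure.pi fun _ : ι => ν.withDensity fun a => ENNReal.ofReal (p a)) =
      (Measure.pi fun _ : ι => ν).withDensity fun ω => ENNReal.ofReal (∏ i, p (ω i)) := by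
  have := isFiniteMeasure_withDensity_ofReal hpi.2
  refine (Measure.pi_eq fun S hS => ?_)
  have hint : ∀ i, Integrable ((S i).indicator p) ν := fun i => hpi.indicator (hS i)
  have h1 : ∀ ω : ι → α, (Set.univ.pi S).indicator (fun ω => ∏ i, p (ω i)) ω
      = ∏ i, (S i).indicator p (ω i) := by
    intro ω
    by_cases h : ω ∈ Set.univ.pi S
    · rw [Set.indicator_of_mem h]
      exact Finset.prod_congr rfl fun i _ =>
        (Set.indicator_of_mem (h i (Set.mem_univ i)) _).symm
    · rw [Set.indicator_of_notMem h]
      obtain ⟨i, hi⟩ : ∃ i, ω i ∉ S i := by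
        by_contra! hcon
        exact h fun i _ => hcon i
      exact (Finset.prod_eq_zero (Finset.mem_univ i) (Set.indicator_of_notMem hi _)).symm
  have h2 : ∀ i, ν.withDensity (fun a => ENNReal.ofReal (p a)) (S i)
      = ENNReal.ofReal (∫ a, (S i).indicator p a ∂ν) := by
    intro i
    rw [withDensity_apply _ (hS i), integral_indicator (hS i),
      ofReal_integral_eq_lintegral_ofReal hpi.integrableOn
        (Filter.Eventually.of_forall fun a => hp0 a)]
  rw [withDensity_apply _ (MeasurableSet.univ_pi hS)]
  simp only [h2]
  rw [← ENNReal.ofReal_prod_of_nonneg fun i _ =>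
    integral_nonneg fun a => Set.indicator_nonneg (fun a _ => hp0 a) a,
    ← integral_fintype_prod_eq_prod (𝕜 := ℝ) (fun i => (S i).indicator p)]
  have h3 : Integrable (fun ω : ι → α => ∏ i, (S i).indicator p (ω i))
      (Measure.pi fun _ : ι => ν) := Integrable.fintype_prod_dep hint
  rw [ofReal_integral_eq_lintegral_ofReal h3 (Filter.Eventually.of_forall fun ω =>
    Finset.prod_nonneg fun i _ => Set.indicator_nonneg (fun a _ => hp0 a) _),
    ← lintegral_indicator (MeasurableSet.univ_pi hS)]
  congr 1
  funext ω
  rw [← h1]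
  by_cases h : ω ∈ Set.univ.pi S <;> simp [h]

/-- Shearing the coordinates with property `P` by a function of the others preserves the product
measure. -/
theorem measurePreserving_shear {ι V : Type*} [Fintype ι] [NormedAddCommGroup V]
    [MeasurableSpace V] [BorelSpace V] [SecondCountableTopology V] (ν : Measure V) [SigmaFinite ν]
    [ν.IsAddRightInvariant] (P : ι → Prop) [DecidablePred P]
    {d : (ι → V) → ι → V} (hd : Measurable d)
    (hdep : ∀ ω ω' : ι → V, (∀ i, ¬ P i → ω i = ω' i) → ∀ i, P i → d ω i = d ω' i) :
    MeasurePreserving (fun ω i => if P i then ω i + d ω i else ω i)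
      (Measure.pi fun _ : ι => ν) (Measure.pi fun _ : ι => ν) := by
  have hi : MeasurePreserving (fun (ω : {i // P i} → V) (i : {i // P i}) => ω i)
    (Measure.pi fun _ : {i // P i} => ν) (Measure.pi fun _ : {i // P i} => ν) :=
    MeasurePreserving.id _
  set e := MeasurableEquiv.piEquivPiSubtypeProd (fun _ : ι => V) P with he
  have hmp : MeasurePreserving e (Measure.pi fun _ : ι => ν)
      ((Measure.pi fun _ : {i // P i} => ν).prod (Measure.pi fun _ : {i // ¬ P i} => ν)) :=
    measurePreserving_piEquivPiSubtypeProd (fun _ : ι => ν) P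
  -- The coordinates in `P` are filled with `0`; by `hdep` the displacement does not look at them.
  have hd' : Measurable fun x : {i // ¬ P i} → V =>
      fun i : {i // P i} => d (e.symm (0, x)) i := by
    refine measurable_pi_lambda _ fun i => ?_
    exact (measurable_pi_apply _).comp (hd.comp (e.symm.measurable.comp (by fun_prop)))
  have hsk : MeasurePreserving (fun q : ({i // ¬ P i} → V) × ({i // P i} → V) =>
      (q.1, q.2 + fun i : {i // P i} => d (e.symm (0, q.1)) i))
      ((Measure.pi fun _ : {i // ¬ P i} => ν).prod (Measure.pi fun _ : {i // P i} => ν))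
      ((Measure.pi fun _ : {i // ¬ P i} => ν).prod (Measure.pi fun _ : {i // P i} => ν)) := by
    refine (MeasurePreserving.id _).skew_product
      (g := fun x y => y + fun i : {i // P i} => d (e.symm (0, x)) i) ?_ ?_
    · exact measurable_snd.add (hd'.comp measurable_fst)
    · refine Filter.Eventually.of_forall fun x => ?_
      exact (measurePreserving_add_right _ _).map_eq
  have hcomp := hmp.symm.comp (Measure.measurePreserving_swap.comp
    (hsk.comp (Measure.measurePreserving_swap.comp hmp)))
  convert hcomp using 1
  funext ω
  symm
  simp only [Function.comp]
  rw [MeasurableEquiv.symm_apply_eq]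
  have hdd : ∀ i : {i // P i}, d (e.symm (0, (e ω).2)) i = d ω i := by
    intro i
    refine hdep _ _ (fun j hj => ?_) i i.2
    simp [he, MeasurableEquiv.piEquivPiSubtypeProd, Equiv.piEquivPiSubtypeProd, hj]
  refine Prod.ext ?_ ?_
  · funext i
    simp only [Prod.swap, Pi.add_apply, hdd]
    simp [he, MeasurableEquiv.piEquivPiSubtypeProd, Equiv.piEquivPiSubtypeProd, i.2]
  · funext i
    simp [he, MeasurableEquiv.piEquivPiSubtypeProd, Equiv.piEquivPiSubtypeProd, i.2]

/-- A triangular translation preserves the product measure. -/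
theorem measurePreserving_triangular {ι V : Type*} [Fintype ι] [NormedAddCommGroup V]
    [MeasurableSpace V] [BorelSpace V] [SecondCountableTopology V] (ν : Measure V) [SigmaFinite ν]
    [ν.IsAddRightInvariant] (r : ι → ℕ) {d : (ι → V) → ι → V} (hd : Measurable d)
    (hdep : ∀ ω ω' : ι → V, ∀ i, (∀ j, r j < r i → ω j = ω' j) → d ω i = d ω' i) (m : ℕ)
    (hm : ∀ i, r i < m) :
    MeasurePreserving (fun ω => ω + d ω) (Measure.pi fun _ : ι => ν)
      (Measure.pi fun _ : ι => ν) := by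
  suffices h : ∀ m, MeasurePreserving (fun ω i => if r i < m then ω i + d ω i else ω i)
      (Measure.pi fun _ : ι => ν) (Measure.pi fun _ : ι => ν) by
    convert h m using 1
    funext ω i
    simp [hm i]
  intro m
  induction m with
  | zero =>
    simp only [Nat.not_lt_zero, if_false]
    exact MeasurePreserving.id _
  | succ m ih =>
    -- Rank `m` moves first, while the lower ranks still have the values that determine its
    -- displacement; the displacements of lower ranks do not see rank `m`.
    have hsh := measurePreserving_shear ν (fun i => r i = m) hd fun ω ω' h i hi =>
      hdep ω ω' i fun j hj => h j (by omega)
    convert ih.comp hsh using 1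
    funext ω i
    simp only [Function.comp]
    have hdd : r i ≤ m → d (fun i => if r i = m then ω i + d ω i else ω i) i = d ω i := by
      intro hi
      refine hdep _ _ i fun j hj => ?_
      rw [if_neg (by omega)]
    rcases lt_trichotomy (r i) m with h | h | h
    · simp [h, h.ne, h.le, hdd, Nat.lt_succ_of_lt h]
    · simp [h]
    · simp [h.ne', not_lt.2 h.le, show ¬ r i < m + 1 by omega]

/-! ### The law of the noise -/

theorem levels_pos (T : ℕ) : 0 < levels T := Nat.succ_pos _

theorem noiseScale_pos {T : ℕ} {G ε : ℝ} (hG : 0 < G) (hε : 0 < ε) : 0 < noiseScale T G ε := by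
  have : (0 : ℝ) < levels T := by exact_mod_cast levels_pos T
  unfold noiseScale
  positivity

/-- The scale of the noise vectors of every learner. -/
def learnerScale (T : ℕ) (G ε : ℝ) : ℝ := noiseScale T G (ε / (numLearners T : ℝ))

theorem learnerScale_pos {T : ℕ} (hT : 2 ≤ T) {G ε : ℝ} (hG : 0 < G) (hε : 0 < ε) :
    0 < learnerScale T G ε :=
  noiseScale_pos hG (div_pos hε (by exact_mod_cast numLearners_pos hT))

theorem isProbabilityMeasure_noiseMeasure (n : ℕ) {T : ℕ} (hT : 2 ≤ T) {G ε : ℝ} (hG : 0 < G)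
    (hε : 0 < ε) : IsProbabilityMeasure (noiseMeasure n T G ε) := by
  have := isProbabilityMeasure_radialNoise n (learnerScale_pos hT hG hε)
  unfold learnerScale at this
  unfold noiseMeasure
  infer_instance

theorem noiseMeasure_eq (n : ℕ) {T : ℕ} (hT : 2 ≤ T) {G ε : ℝ} (hG : 0 < G) (hε : 0 < ε) :
    noiseMeasure n T G ε = (Measure.pi fun _ => volume).withDensity fun ω : Noise n T =>
      ENNReal.ofReal (∏ i, radialDensity n (learnerScale T G ε) (ω i)) := by
  have hs := learnerScale_pos hT hG hε
  rw [← pi_withDensity_ofReal volume (fun b => (radialDensity_pos hs b).le)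
    (integrable_radialDensity n hs), ← radialNoise_eq n hs]
  rfl

theorem radialDensity_le {n : ℕ} {s : ℝ} (hs : 0 < s) (b d : E n) :
    radialDensity n s b ≤ Real.exp (‖d‖ / s) * radialDensity n s (b + d) := by
  have h := norm_add_le b d
  unfold radialDensity
  rw [mul_left_comm, ← Real.exp_add]
  refine mul_le_mul_of_nonneg_left (Real.exp_le_exp.2 ?_) (inv_pos.2 (radialMass_pos n hs)).le
  rw [← add_div]
  exact div_le_div_of_nonneg_right (by linarith) hs.le

theorem prod_radialDensity_le {ι : Type*} [Fintype ι] {n : ℕ} {s c : ℝ} (hs : 0 < s)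
    (ω d : ι → E n) (hd : ∑ i, ‖d i‖ ≤ c) :
    ∏ i, radialDensity n s (ω i) ≤
      Real.exp (c / s) * ∏ i, radialDensity n s ((ω + d) i) := by
  calc ∏ i, radialDensity n s (ω i)
      ≤ ∏ i, (Real.exp (‖d i‖ / s) * radialDensity n s ((ω + d) i)) :=
        Finset.prod_le_prod (fun i _ => (radialDensity_pos hs _).le)
          fun i _ => radialDensity_le hs _ _
    _ = Real.exp ((∑ i, ‖d i‖) / s) * ∏ i, radialDensity n s ((ω + d) i) := by
        rw [Finset.prod_mul_distrib, ← Real.exp_sum, Finset.sum_div]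
    _ ≤ _ := mul_le_mul_of_nonneg_right
        (Real.exp_le_exp.2 (div_le_div_of_nonneg_right hd hs.le))
        (Finset.prod_nonneg fun i _ => (radialDensity_pos hs _).le)

/-! ### Coupling of neighbouring inputs -/

/-- Information flows only from earlier to later learners: the gradients fed to learner `i` are
taken at averages of the directions of learners before `i`. This makes the translation of the noise
triangular in the learner index. -/
theorem queryPoint_congr_noise {n T : ℕ} {X : Set (E n)} {β G : ℝ} (ε : ℝ) (init : ℕ → E n)
    (F : Fin T → Payoff X β G) {ω ω' : Noise n T} {k : ℕ}
    (h : ∀ i < k, learnerNoise ω i = learnerNoise ω' i) (t : ℕ) :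
    queryPoint ε init F ω k t = queryPoint ε init F ω' k t := by
  induction k using Nat.strong_induction_on generalizing t with
  | _ k ih =>
    unfold queryPoint
    congr 1
    refine Finset.sum_congr rfl fun i hi => ?_
    have hik := Finset.mem_range.1 hi
    rw [direction_eq, direction_eq, h i hik]
    congr 1
    funext t _
    unfold costVector
    rw [ih i hik (fun j hj => h j (hj.trans hik)) t]

section Coupling

variable {n T : ℕ} {X : Set (E n)} {β G : ℝ} (ε : ℝ) (init : ℕ → E n)
    (F F' : Fin T → Payoff X β G) (t₀ : Fin T)

/-- The difference between the gradients revealed to learner `k` in round `t₀`. -/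
def gradientGap (ω : Noise n T) (k : ℕ) : E n :=
  (F' t₀).grad (queryPoint ε init F ω k t₀) - (F t₀).grad (queryPoint ε init F ω k t₀)

/-- The translation of the noise that compensates for a change of the payoff in round `t₀`. -/
def noiseShift (ω : Noise n T) : Noise n T := fun p =>
  if (t₀ : ℕ) / 2 ^ (p.2.1 : ℕ) = (p.2.2 : ℕ) then gradientGap ε init F F' t₀ ω p.1 else 0

theorem noiseShift_congr {ω ω' : Noise n T} {p : Fin (numLearners T) × Fin (levels T) × Fin T}
    (h : ∀ q : Fin (numLearners T) × Fin (levels T) × Fin T, q.1 < p.1 → ω q = ω' q) :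
    noiseShift ε init F F' t₀ ω p = noiseShift ε init F F' t₀ ω' p := by
  have hq : queryPoint ε init F ω p.1 t₀ = queryPoint ε init F ω' p.1 t₀ := by
    refine queryPoint_congr_noise ε init F (fun i hi => ?_) t₀
    have hiK : i < numLearners T := hi.trans p.1.2
    funext l j
    simp only [learnerNoise, hiK, dif_pos]
    exact h (⟨i, hiK⟩, l, j) hi
  simp only [noiseShift, gradientGap, hq]

end Coupling

section CouplingInBox

variable {n T : ℕ} {I : Fin n → Set ℝ} {β G : ℝ} {ε : ℝ} {init : ℕ → E n}

theorem measurable_noiseShift (hT : 2 ≤ T) (hε : 0 < ε) (hI : Admissible I)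
    (hinit : ∀ k, init k ∈ box I) (F F' : Fin T → Payoff (box I) β G) (t₀ : Fin T) :
    Measurable (noiseShift ε init F F' t₀) := by
  refine measurable_pi_lambda _ fun p => ?_
  unfold noiseShift
  split_ifs
  · exact (measurable_grad_queryPoint hT hε hI hinit F p.1.2.le _ _).sub
      (measurable_grad_queryPoint hT hε hI hinit F p.1.2.le _ _)
  · exact measurable_const

theorem norm_gradientGap_le (hI : Admissible I) (hinit : ∀ k, init k ∈ box I)
    (F F' : Fin T → Payoff (box I) β G) (t₀ : Fin T) (ω : Noise n T) {k : ℕ}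
    (hk : k ≤ numLearners T) : ‖gradientGap ε init F F' t₀ ω k‖ ≤ 2 * G := by
  have hq := queryPoint_mem (ε := ε) hI hinit F ω hk t₀
  have h1 := (F t₀).grad_bound _ hq
  have h2 := (F' t₀).grad_bound _ hq
  have := norm_sub_le ((F' t₀).grad (queryPoint ε init F ω k t₀))
    ((F t₀).grad (queryPoint ε init F ω k t₀))
  unfold gradientGap
  linarith

/-- At each level exactly one block contains `t₀`, and its noise moves by at most `2 * G`. The total
is `ε` times the noise scale, which is how that scale is calibrated. -/
theorem sum_norm_noiseShift_le (hI : Admissible I) (hinit : ∀ k, init k ∈ box I)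
    (F F' : Fin T → Payoff (box I) β G) (t₀ : Fin T) (ω : Noise n T) :
    ∑ p, ‖noiseShift ε init F F' t₀ ω p‖ ≤ numLearners T * (levels T * (2 * G)) := by
  have hj : ∀ (k : Fin (numLearners T)) (i : Fin (levels T)),
      ∑ j : Fin T, ‖noiseShift ε init F F' t₀ ω (k, i, j)‖ ≤ 2 * G := by
    intro k i
    have hlt : (t₀ : ℕ) / 2 ^ (i : ℕ) < T := (Nat.div_le_self _ _).trans_lt t₀.2
    rw [Finset.sum_eq_single ⟨(t₀ : ℕ) / 2 ^ (i : ℕ), hlt⟩]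
    · simp only [noiseShift, if_true]
      exact norm_gradientGap_le hI hinit F F' t₀ ω k.2.le
    · intro j _ hne
      simp only [noiseShift]
      rw [if_neg, norm_zero]
      intro h
      exact hne (Fin.ext h.symm)
    · intro h
      exact absurd (Finset.mem_univ _) h
  rw [Fintype.sum_prod_type]
  simp only [Fintype.sum_prod_type]
  calc _ ≤ ∑ k : Fin (numLearners T), ∑ i : Fin (levels T), 2 * G :=
        Finset.sum_le_sum fun k _ => Finset.sum_le_sum fun i _ => hj k i
    _ = _ := by simp

/-- Translating the noise by `noiseShift` turns the run on `F` into the run on `F'`. -/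
theorem direction_add_noiseShift (hI : Admissible I) (hinit : ∀ k, init k ∈ box I)
    (F F' : Fin T → Payoff (box I) β G) (t₀ : Fin T)
    (hF : ∀ t, t ≠ t₀ → ∀ x ∈ box I, (F t).val x = (F' t).val x ∧ (F t).grad x = (F' t).grad x)
    (ω : Noise n T) {k : ℕ} (hk : k < numLearners T) {t : ℕ} (ht : t < T) :
    direction ε init F ω k t = direction ε init F' (ω + noiseShift ε init F F' t₀ ω) k t := by
  induction k using Nat.strong_induction_on generalizing t with
  | _ k ih =>
    set ω' := ω + noiseShift ε init F F' t₀ ω with hω'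
    have hq : ∀ t < T, queryPoint ε init F ω k t = queryPoint ε init F' ω' k t := by
      intro t ht
      unfold queryPoint
      congr 1
      refine Finset.sum_congr rfl fun i hi => ?_
      have hik := Finset.mem_range.1 hi
      exact ih i hik (hik.trans hk) ht
    -- Both runs query the same point because the earlier learners agree, so the costs differ only
    -- in round `t₀`, by the gap.
    have hcost : ∀ τ < T, costVector ε init F ω k τ = costVector ε init F' ω' k τ
        + if τ = (t₀ : ℕ) then gradientGap ε init F F' t₀ ω k else 0 := by
      intro τ hτ
      simp only [costVector, hτ, dif_pos]
      split_ifs with h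
      · subst h
        rw [← hq _ hτ, gradientGap]
        abel
      · rw [add_zero, ← hq _ hτ, (hF ⟨τ, hτ⟩ (fun h' => h (congrArg Fin.val h')) _
          (queryPoint_mem hI hinit F ω hk.le τ)).2]
    rw [direction_eq, direction_eq]
    -- Iterates before `T` use only blocks ending before `T`, on which `hcost` applies.
    refine pftal_congr _ _ _ (m := T) (fun i j hij => ?_) ht
    have hmem : (t₀ : ℕ) ∈ Finset.Ico ((j : ℕ) * 2 ^ (i : ℕ)) (((j : ℕ) + 1) * 2 ^ (i : ℕ)) ↔
        (t₀ : ℕ) / 2 ^ (i : ℕ) = (j : ℕ) := by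
      have h2 : 0 < 2 ^ (i : ℕ) := by positivity
      rw [Finset.mem_Ico, ← Nat.le_div_iff_mul_le h2, ← Nat.div_lt_iff_lt_mul h2]
      omega
    unfold nodeValue
    rw [Finset.sum_congr rfl fun τ hτ =>
      hcost τ ((Finset.mem_Ico.1 hτ).2.trans hij), Finset.sum_add_distrib,
      Finset.sum_ite_eq', add_assoc]
    congr 1
    simp only [learnerNoise, hk, dif_pos, hω', Pi.add_apply, noiseShift, hmem]
    rw [add_comm]

/-- The algorithm is differentially private. -/
theorem isDP_outputLaw (hT : 2 ≤ T) (hG : 0 < G) (hε : 0 < ε) (hI : Admissible I)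
    (hinit : ∀ k, init k ∈ box I) :
    IsDP Neighboring (fun F : Fin T → Payoff (box I) β G => outputLaw ε init F) ε 0 := by
  rintro F F' ⟨t₀, hF⟩ S hS
  rw [ENNReal.ofReal_zero, add_zero]
  have hplay : ∀ ω, play ε init F ω = play ε init F' (ω + noiseShift ε init F F' t₀ ω) := by
    intro ω
    funext t
    unfold play
    congr 1
    exact Finset.sum_congr rfl fun k _ => direction_add_noiseShift hI hinit F F' t₀ hF ω k.2 t.2
  have hK : (0 : ℝ) < numLearners T := by exact_mod_cast numLearners_pos hT
  have hL : (0 : ℝ) < levels T := by exact_mod_cast levels_pos T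
  have hs := learnerScale_pos hT hG hε
  set q : Noise n T → ℝ := fun ω => ∏ i, radialDensity n (learnerScale T G ε) (ω i) with hqdef
  have hq : ∀ ω, q ω ≤ Real.exp ε * q (ω + noiseShift ε init F F' t₀ ω) := by
    intro ω
    have h := prod_radialDensity_le hs ω (noiseShift ε init F F' t₀ ω)
      (sum_norm_noiseShift_le (ε := ε) hI hinit F F' t₀ ω)
    convert h using 3
    unfold learnerScale noiseScale
    field_simp
  have hqm : Measurable q := Finset.measurable_prod _ fun i _ =>
    (measurable_radialDensity n _).comp (measurable_pi_apply i)
  have hmp : MeasurePreserving (fun ω : Noise n T => ω + noiseShift ε init F F' t₀ ω)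
      (Measure.pi fun _ => volume) (Measure.pi fun _ => volume) :=
    measurePreserving_triangular volume (fun p => (p.1 : ℕ))
      (measurable_noiseShift hT hε hI hinit F F' t₀)
      (fun ω ω' p h => noiseShift_congr ε init F F' t₀ fun q hq => h q hq)
      (numLearners T) fun p => p.1.2
  have hA := measurable_play hT hε hI hinit F hS
  have hA' := measurable_play hT hε hI hinit F' hS
  unfold outputLaw
  -- Substituting the translated noise in the integral for `F'` makes both integrals refer to the
  -- same played points; the integrands then compare pointwise.
  rw [Measure.map_apply (measurable_play hT hε hI hinit F) hS,
    Measure.map_apply (measurable_play hT hε hI hinit F') hS, noiseMeasure_eq n hT hG hε,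
    withDensity_apply _ hA, withDensity_apply _ hA', ← lintegral_indicator hA,
    ← lintegral_indicator hA', ← hmp.lintegral_comp
      (hqm.ennreal_ofReal.indicator hA'), ← lintegral_const_mul' _ _ ENNReal.ofReal_ne_top]
  refine lintegral_mono fun ω => ?_
  by_cases h : ω ∈ play ε init F ⁻¹' S
  · have h' : ω + noiseShift ε init F F' t₀ ω ∈ play ε init F' ⁻¹' S := by
      rw [Set.mem_preimage, ← hplay]
      exact h
    simp only [Set.indicator_of_mem h, Set.indicator_of_mem h']
    rw [← ENNReal.ofReal_mul (Real.exp_pos _).le]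
    exact ENNReal.ofReal_le_ofReal (hq ω)
  · simp only [Set.indicator_of_notMem h]
    exact zero_le

end CouplingInBox

/-! ### Regret of PFTAL on linear costs -/

/-- The total noise in the private version of the `t`-th partial sum. -/
def treeNoise {n T : ℕ} (noise : Fin (levels T) → Fin T → E n) (t : ℕ) : E n :=
  privateSum noise (fun _ => 0) t

theorem treeNoise_eq {n T : ℕ} (noise : Fin (levels T) → Fin T → E n) (t : ℕ) :
    treeNoise noise t = ∑ i : Fin (levels T), ∑ j : Fin T,
      if t.testBit i = true ∧ t / 2 ^ (i : ℕ) = (j : ℕ) + 1 then noise i j else 0 := by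
  simp [treeNoise, privateSum, nodeValue]

/-- Let `P i` be the sum up to `t` with its lowest `i` bits cleared. A block of level `i`, present
when bit `i` is `1`, fills the gap between `P (i + 1)` and `P i`, so the levels telescope. -/
theorem privateSum_eq {n T : ℕ} (noise : Fin (levels T) → Fin T → E n) (g : ℕ → E n) {t : ℕ}
    (ht : t ≤ T) :
    privateSum noise g t = ∑ τ ∈ Finset.range t, g τ + treeNoise noise t := by
  have h1 : privateSum noise g t = (∑ i : Fin (levels T), ∑ j : Fin T,
      if t.testBit i = true ∧ t / 2 ^ (i : ℕ) = (j : ℕ) + 1 then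
        ∑ τ ∈ Finset.Ico ((j : ℕ) * 2 ^ (i : ℕ)) (((j : ℕ) + 1) * 2 ^ (i : ℕ)), g τ else 0)
      + treeNoise noise t := by
    rw [treeNoise_eq]
    simp only [privateSum, nodeValue, ← Finset.sum_add_distrib]
    refine Finset.sum_congr rfl fun i _ => Finset.sum_congr rfl fun j _ => ?_
    split_ifs <;> simp
  rw [h1]
  congr 1
  set P : ℕ → E n := fun i => ∑ τ ∈ Finset.range (t / 2 ^ i * 2 ^ i), g τ with hP
  have h2 : ∀ i : Fin (levels T), (∑ j : Fin T,
      if t.testBit i = true ∧ t / 2 ^ (i : ℕ) = (j : ℕ) + 1 then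
        ∑ τ ∈ Finset.Ico ((j : ℕ) * 2 ^ (i : ℕ)) (((j : ℕ) + 1) * 2 ^ (i : ℕ)), g τ else 0)
      = P i - P (i + 1) := by
    intro i
    have hdiv : t / 2 ^ ((i : ℕ) + 1) = t / 2 ^ (i : ℕ) / 2 := by
      rw [pow_succ, Nat.div_div_eq_div_mul]
    have hmod := Nat.div_add_mod (t / 2 ^ (i : ℕ)) 2
    have hbit : t.testBit i = true ↔ t / 2 ^ (i : ℕ) % 2 = 1 := by
      rw [Nat.testBit_eq_decide_div_mod_eq, decide_eq_true_iff]
    by_cases h : t / 2 ^ (i : ℕ) % 2 = 1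
    · have hle : t / 2 ^ (i : ℕ) ≤ t := Nat.div_le_self _ _
      have hj : t / 2 ^ (i : ℕ) - 1 < T := by omega
      rw [Finset.sum_eq_single ⟨t / 2 ^ (i : ℕ) - 1, hj⟩]
      · have hs : t / 2 ^ (i : ℕ) - 1 + 1 = t / 2 ^ (i : ℕ) := by omega
        have hs2 : t / 2 ^ ((i : ℕ) + 1) * 2 ^ ((i : ℕ) + 1)
            = (t / 2 ^ (i : ℕ) - 1) * 2 ^ (i : ℕ) := by
          rw [hdiv, pow_succ, mul_comm (2 ^ (i : ℕ)) 2, ← mul_assoc]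
          congr 1
          omega
        simp only [hs, hbit, h, and_self, if_true, hP, hs2]
        rw [Finset.sum_Ico_eq_sub _ (Nat.mul_le_mul_right _ (Nat.sub_le _ _))]
      · intro j _ hne
        rw [if_neg]
        rintro ⟨-, h3⟩
        exact hne (Fin.ext (by simp only; omega))
      · intro h'
        exact absurd (Finset.mem_univ _) h'
    · have hs2 : t / 2 ^ ((i : ℕ) + 1) * 2 ^ ((i : ℕ) + 1) = t / 2 ^ (i : ℕ) * 2 ^ (i : ℕ) := by
        rw [hdiv, pow_succ, mul_comm (2 ^ (i : ℕ)) 2, ← mul_assoc]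
        congr 1
        omega
      simp [hbit, h, hP, hs2]
  simp only [h2]
  rw [Fin.sum_univ_eq_sum_range (fun i => P i - P (i + 1)), Finset.sum_range_sub']
  -- Clearing all `levels T` bits leaves the empty sum.
  have hlt : t < 2 ^ levels T := ht.trans_lt (Nat.lt_pow_succ_log_self one_lt_two T)
  simp [hP, Nat.div_eq_of_lt hlt]

/-- Following the leader while peeking one round ahead has no regret. -/
theorem beTheLeader {V : Type*} {X : Set V} {ℓ : ℕ → V → ℝ} {p : ℕ → V} (hp : ∀ t, p t ∈ X)
    (hmin : ∀ t, ∀ u ∈ X, ∑ τ ∈ Finset.range t, ℓ τ (p t) ≤ ∑ τ ∈ Finset.range t, ℓ τ u) (t : ℕ) :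
    ∑ τ ∈ Finset.range t, ℓ τ (p (τ + 1)) ≤ ∑ τ ∈ Finset.range t, ℓ τ (p t) := by
  induction t with
  | zero => simp
  | succ t ih =>
    rw [Finset.sum_range_succ, Finset.sum_range_succ _ t]
    have := hmin t _ (hp (t + 1))
    linarith

/-- The reference point `p (t + 1)` minimizes the noiseless objective that includes the current cost
and has the actual iterates as centres. It has no regret up to the regularizer, and strong convexity
of modulus `H * (t + 1)` keeps `w t` close to it. Noise enters only through this distance, so the
costs may be adaptive. -/
theorem pftal_regret {n T : ℕ} {X : Set (E n)} (hX : IsCompact X) (hXc : Convex ℝ X) {H : ℝ}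
    (hH : 0 < H) {w₀ : E n} (hw₀ : w₀ ∈ X) (noise : Fin (levels T) → Fin T → E n) {g : ℕ → E n}
    {G D : ℝ} (hg : ∀ t, ‖g t‖ ≤ G) (hD : ∀ x ∈ X, ∀ y ∈ X, ‖x - y‖ ≤ D) {u : E n} (hu : u ∈ X) :
    ∑ t ∈ Finset.range T, inner ℝ (g t) (pftal X H w₀ noise (fun τ _ => g τ) t - u) ≤
      H / 2 * D ^ 2 * T +
        ∑ t ∈ Finset.range T, G * (G + ‖treeNoise noise t‖) / (H * (t + 1 : ℕ)) := by
  set w : ℕ → E n := fun t => pftal X H w₀ noise (fun τ _ => g τ) t with hw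
  have hwX : ∀ t, w t ∈ X := fun t => pftal_mem hX H hw₀ _ _ _
  set φ : ℕ → E n → ℝ := fun t v => inner ℝ (∑ τ ∈ Finset.range t, g τ) v
    + H / 2 * ∑ τ ∈ Finset.range t, ‖v - w τ‖ ^ 2 with hφ
  set ℓ : ℕ → E n → ℝ := fun τ v => inner ℝ (g τ) v + H / 2 * ‖v - w τ‖ ^ 2 with hℓ
  have hφℓ : ∀ t v, φ t v = ∑ τ ∈ Finset.range t, ℓ τ v := by
    intro t v
    simp only [hφ, hℓ, sum_inner, Finset.sum_add_distrib, Finset.mul_sum]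
  set p : ℕ → E n := fun t => argminOn X (φ t) with hp
  have hpspec : ∀ t, p t ∈ X ∧ IsMinOn (φ t) X (p t) := fun t =>
    argminOn_spec hX ⟨w₀, hw₀⟩ (by simp only [hφ]; fun_prop)
  have hbtl := beTheLeader (X := X) (ℓ := ℓ) (p := p) (fun t => (hpspec t).1) (fun t u hu => by
    rw [← hφℓ, ← hφℓ]
    exact (hpspec t).2 hu) T
  have hmin : ∑ τ ∈ Finset.range T, ℓ τ (p T) ≤ ∑ τ ∈ Finset.range T, ℓ τ u := by
    rw [← hφℓ, ← hφℓ]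
    exact (hpspec T).2 hu
  have hclose : ∀ t, t < T → H * (t + 1 : ℕ) * ‖w t - p (t + 1)‖ ≤ G + ‖treeNoise noise t‖ := by
    intro t ht
    set s := ∑ τ ∈ Finset.range t, g τ with hs
    have h1 : 0 ≤ inner ℝ ((s + treeNoise noise t - H • ∑ τ ∈ Finset.range (t + 1), w τ)
        + (H * (t + 1 : ℕ)) • w t) (p (t + 1) - w t) := by
      -- The squared distance to `w t` has zero gradient at `w t`, so including it keeps `w t`
      -- optimal and gives both points the same modulus.
      have h2 : (s + treeNoise noise t - H • ∑ τ ∈ Finset.range (t + 1), w τ)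
        + (H * (t + 1 : ℕ)) • w t =
          s + treeNoise noise t - H • ∑ τ ∈ Finset.range t, w τ + (H * t) • w t := by
        rw [Finset.sum_range_succ]
        push_cast
        module
      rw [h2]
      -- The first iterate minimizes nothing, but at `t = 0` the vector in the inequality is `0`.
      rcases Nat.eq_zero_or_pos t with h0 | h0
      · simp [hs, h0, treeNoise_eq]
      · obtain ⟨m, rfl⟩ : ∃ m, t = m + 1 := ⟨t - 1, by omega⟩
        have h3 := pftal_succ_spec hX ⟨w₀, hw₀⟩ H w₀ noise g m
        have h4 := variationalInequality hXc h3.1 h3.2 (hpspec (m + 1 + 1)).1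
        rwa [privateSum_eq _ _ ht.le, Finset.card_range] at h4
    have h5 := variationalInequality hXc (hpspec (t + 1)).1 (hpspec (t + 1)).2 (hwX t)
    rw [Finset.card_range] at h5
    refine (norm_sub_le_of_variationalInequality h1 h5).trans ?_
    have h6 : s + treeNoise noise t - H • ∑ τ ∈ Finset.range (t + 1), w τ
        - (∑ τ ∈ Finset.range (t + 1), g τ - H • ∑ τ ∈ Finset.range (t + 1), w τ)
        = treeNoise noise t - g t := by
      rw [Finset.sum_range_succ g]
      abel
    rw [h6]
    have := norm_sub_le (treeNoise noise t) (g t)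
    have := hg t
    linarith
  have hG : 0 ≤ G := (norm_nonneg _).trans (hg 0)
  have hterm : ∀ t ∈ Finset.range T, inner ℝ (g t) (w t - u) ≤
      (H / 2 * D ^ 2 + G * (G + ‖treeNoise noise t‖) / (H * (t + 1 : ℕ)))
        + (ℓ t (p (t + 1)) - ℓ t u) := by
    intro t ht
    have hc : 0 < H * (t + 1 : ℕ) := by positivity
    have h1 : inner ℝ (g t) (w t - p (t + 1)) ≤ G * (G + ‖treeNoise noise t‖) /
        (H * (t + 1 : ℕ)) := by
      calc inner ℝ (g t) (w t - p (t + 1)) ≤ ‖g t‖ * ‖w t - p (t + 1)‖ := real_inner_le_norm _ _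
        _ ≤ G * ((G + ‖treeNoise noise t‖) / (H * (t + 1 : ℕ))) := by
            refine mul_le_mul (hg t) ?_ (norm_nonneg _) hG
            rw [le_div_iff₀ hc, mul_comm]
            exact hclose t (Finset.mem_range.1 ht)
        _ = _ := by ring
    have h2 : ‖u - w t‖ ^ 2 ≤ D ^ 2 := pow_le_pow_left₀ (norm_nonneg _) (hD _ hu _ (hwX t)) 2
    have h3 : 0 ≤ H / 2 * ‖p (t + 1) - w t‖ ^ 2 := by positivity
    have h4 : H / 2 * ‖u - w t‖ ^ 2 ≤ H / 2 * D ^ 2 :=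
      mul_le_mul_of_nonneg_left h2 (by positivity)
    simp only [hℓ]
    rw [inner_sub_right] at h1 ⊢
    linarith
  refine (Finset.sum_le_sum hterm).trans ?_
  rw [Finset.sum_add_distrib, Finset.sum_add_distrib, Finset.sum_sub_distrib, Finset.sum_const,
    Finset.card_range, nsmul_eq_mul]
  linarith

/-! ### Smoothness and concavity of payoffs -/

theorem inner_le_inner_of_coordLE {n : ℕ} {a b c : E n} (hab : CoordLE a b) (hc : CoordLE 0 c) :
    inner ℝ a c ≤ inner ℝ b c := by
  simp only [PiLp.inner_apply]
  refine Finset.sum_le_sum fun i _ => ?_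
  have h1 := hab i
  have h2 : 0 ≤ c i := hc i
  simpa using mul_le_mul_of_nonneg_left h1 h2

namespace Payoff

variable {n : ℕ} {β G : ℝ}

/-- Mean value theorem; gradients relative to `X` suffice because the segment stays in `X`. -/
theorem exists_segment_eq {X : Set (E n)} (hX : Convex ℝ X) (f : Payoff X β G) {x y : E n}
    (hx : x ∈ X) (hy : y ∈ X) :
    ∃ s ∈ Set.Ioo (0 : ℝ) 1,
      f.val y - f.val x = inner ℝ (f.grad (x + s • (y - x))) (y - x) := by
  have hmem : ∀ s ∈ Set.Icc (0 : ℝ) 1, x + s • (y - x) ∈ X := fun s hs =>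
    hX.add_smul_sub_mem hx hy hs
  have hder : ∀ s ∈ Set.Icc (0 : ℝ) 1, HasDerivWithinAt (fun s : ℝ => f.val (x + s • (y - x)))
      (inner ℝ (f.grad (x + s • (y - x))) (y - x)) (Set.Icc 0 1) s := by
    intro s hs
    have h1 := (f.hasGradient _ (hmem s hs)).hasFDerivWithinAt
    have h2 : HasDerivWithinAt (fun s : ℝ => x + s • (y - x)) (y - x) (Set.Icc 0 1) s := by
      simpa using (((hasDerivAt_id s).smul_const (y - x)).const_add x).hasDerivWithinAt
    have h3 := h1.comp_hasDerivWithinAt s h2 hmem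
    rw [InnerProductSpace.toDual_apply_apply] at h3
    exact h3
  obtain ⟨s, hs, hs'⟩ := exists_hasDerivAt_eq_slope (fun s : ℝ => f.val (x + s • (y - x)))
    (fun s => inner ℝ (f.grad (x + s • (y - x))) (y - x)) one_pos
    (fun s hs => (hder s hs).continuousWithinAt)
    (fun s hs => (hder s (Set.Ioo_subset_Icc_self hs)).hasDerivAt (Icc_mem_nhds hs.1 hs.2))
  refine ⟨s, hs, ?_⟩
  rw [hs']
  simp

/-- Payoffs are concave along nonnegative directions. -/
theorem val_sub_le {X : Set (E n)} (hX : Convex ℝ X) (f : Payoff X β G) {x y : E n}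
    (hx : x ∈ X) (hy : y ∈ X) (hxy : CoordLE x y) :
    f.val y - f.val x ≤ inner ℝ (f.grad x) (y - x) := by
  obtain ⟨s, hs, h⟩ := f.exists_segment_eq hX hx hy
  rw [h]
  have hd : CoordLE 0 (y - x) := fun i => by simpa using hxy i
  refine inner_le_inner_of_coordLE (f.drSubmodular _ hx _
    (hX.add_smul_sub_mem hx hy (Set.Ioo_subset_Icc_self hs)) fun i => ?_) hd
  have h1 : 0 ≤ s * (y i - x i) := mul_nonneg hs.1.le (sub_nonneg.2 (hxy i))
  simpa using h1

/-- The mean value theorem gives `β` in place of the sharp `β / 2`, which only affects constants. -/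
theorem le_val_sub {X : Set (E n)} (hX : Convex ℝ X) (hβ : 0 ≤ β) (f : Payoff X β G) {x y : E n}
    (hx : x ∈ X) (hy : y ∈ X) :
    inner ℝ (f.grad x) (y - x) - β * ‖y - x‖ ^ 2 ≤ f.val y - f.val x := by
  obtain ⟨s, hs, h⟩ := f.exists_segment_eq hX hx hy
  have hz := hX.add_smul_sub_mem hx hy (Set.Ioo_subset_Icc_self hs)
  have h1 := f.smooth x hx _ hz
  have h2 : ‖x - (x + s • (y - x))‖ ≤ ‖y - x‖ := by
    rw [show x - (x + s • (y - x)) = -(s • (y - x)) by abel, norm_neg, norm_smul,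
      Real.norm_of_nonneg hs.1.le]
    exact mul_le_of_le_one_left (norm_nonneg _) hs.2.le
  have h3 : inner ℝ (f.grad x - f.grad (x + s • (y - x))) (y - x) ≤ β * ‖y - x‖ ^ 2 := by
    refine (real_inner_le_norm _ _).trans ?_
    rw [sq, ← mul_assoc]
    exact mul_le_mul_of_nonneg_right (h1.trans (mul_le_mul_of_nonneg_left h2 hβ))
      (norm_nonneg _)
  rw [inner_sub_left] at h3
  linarith

/-- Concavity along `z ≤ x` controls only the gradient at the lower point `z`. At `x` a short step
towards `z` is used, and the quadratic error vanishes in the limit. -/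
theorem inner_grad_nonpos_of_le {X : Set (E n)} (hX : Convex ℝ X) (hβ : 0 ≤ β)
    (f : Payoff X β G) {x z : E n} (hx : x ∈ X) (hz : z ∈ X) (hzx : CoordLE z x) :
    inner ℝ (f.grad x) (z - x) ≤ 0 := by
  have key : ∀ s : ℝ, 0 < s → s ≤ 1 → inner ℝ (f.grad x) (z - x) ≤ s * (β * ‖z - x‖ ^ 2) := by
    intro s hs0 hs1
    have hy := hX.add_smul_sub_mem hx hz ⟨hs0.le, hs1⟩
    have h1 := f.le_val_sub hX hβ hx hy
    have h2 : f.val (x + s • (z - x)) ≤ f.val x := by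
      refine f.monotone _ hy _ hx fun i => ?_
      have : s * (z i - x i) ≤ 0 := mul_nonpos_of_nonneg_of_nonpos hs0.le (sub_nonpos.2 (hzx i))
      simpa using this
    rw [add_sub_cancel_left, inner_smul_right, norm_smul, mul_pow, Real.norm_eq_abs, sq_abs] at h1
    have h3 : s * inner ℝ (f.grad x) (z - x) ≤ s * (s * (β * ‖z - x‖ ^ 2)) := by nlinarith
    exact le_of_mul_le_mul_left h3 hs0
  have hlim : Filter.Tendsto (fun s : ℝ => s * (β * ‖z - x‖ ^ 2)) (nhdsWithin 0 (Set.Ioi 0))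
      (nhds 0) := by
    have : Continuous fun s : ℝ => s * (β * ‖z - x‖ ^ 2) := by fun_prop
    simpa using (this.tendsto 0).mono_left nhdsWithin_le_nhds
  refine ge_of_tendsto hlim ?_
  filter_upwards [Ioc_mem_nhdsGT one_pos] with s hs using key s hs.1 hs.2

theorem inner_grad_nonneg_of_le {X : Set (E n)} (hX : Convex ℝ X)
    (f : Payoff X β G) {x z : E n} (hx : x ∈ X) (hz : z ∈ X) (hxz : CoordLE x z) :
    0 ≤ inner ℝ (f.grad x) (z - x) := by
  have h1 := f.val_sub_le hX hx hz hxz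
  have h2 := f.monotone x hx z hz hxz
  linarith

variable {I : Fin n → Set ℝ}

/-- Moving coordinate `i` from `x i` towards `a` reveals the sign. If `I i` is a point, this
component of the oracle is not determined by the values and may be negative. -/
theorem grad_nonneg_of_ne (hI : Admissible I) (hβ : 0 ≤ β) (f : Payoff (box I) β G) {x : E n}
    (hx : x ∈ box I) {i : Fin n} {a : ℝ} (ha : a ∈ I i) (hne : a ≠ x i) : 0 ≤ f.grad x i := by
  set z : E n := x + EuclideanSpace.single i (a - x i) with hz
  have hzi : ∀ j, z j = if j = i then a else x j := by
    intro j
    by_cases h : j = i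
    · subst h
      simp [hz]
    · simp [hz, h]
  have hzX : z ∈ box I := by
    intro j
    rw [hzi]
    split_ifs with h
    · rwa [h]
    · exact hx j
  have hin : inner ℝ (f.grad x) (z - x) = (a - x i) * f.grad x i := by
    rw [hz, add_sub_cancel_left, EuclideanSpace.inner_single_right]
    simp
  rcases lt_or_gt_of_ne hne with h | h
  · have h1 := f.inner_grad_nonpos_of_le (convex_box hI) hβ hx hzX fun j => by
      rw [hzi]
      split_ifs with hj
      · rw [hj]
        exact h.le
      · exact le_rfl
    rw [hin] at h1
    by_contra! hneg
    nlinarith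
  · have h1 := f.inner_grad_nonneg_of_le (convex_box hI) hx hzX fun j => by
      rw [hzi]
      split_ifs with hj
      · rw [hj]
        exact h.le
      · exact le_rfl
    rw [hin] at h1
    exact nonneg_of_mul_nonneg_right h1 (sub_pos.2 h)

/-- The gradient of a monotone payoff is nonnegative along all nonnegative directions spanned by
the box. -/
theorem inner_grad_sub_nonneg (hI : Admissible I) (hβ : 0 ≤ β) (f : Payoff (box I) β G)
    {x y z : E n} (hx : x ∈ box I) (hy : y ∈ box I) (hz : z ∈ box I) (hzy : CoordLE z y) :
    0 ≤ inner ℝ (f.grad x) (y - z) := by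
  rw [PiLp.inner_apply]
  refine Finset.sum_nonneg fun i _ => ?_
  rcases (hzy i).eq_or_lt with h | h
  · simp [h]
  · have hg : 0 ≤ f.grad x i := by
      -- As `z i < y i`, at least one of the two differs from `x i`.
      by_cases hxi : y i = x i
      · exact f.grad_nonneg_of_ne hI hβ hx (hz i) (by rw [← hxi]; exact h.ne)
      · exact f.grad_nonneg_of_ne hI hβ hx (hy i) hxi
    simpa using mul_nonneg (sub_nonneg.2 h.le) hg

end Payoff

/-! ### The Frank-Wolfe recursion -/

/-- The coordinatewise positive part. -/
def coordPos {n : ℕ} (x : E n) : E n := WithLp.toLp 2 fun i => max (x i) 0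

theorem coordPos_mem {n : ℕ} {I : Fin n → Set ℝ} (hI : Admissible I) {x : E n} (hx : x ∈ box I) :
    coordPos x ∈ box I := by
  intro i
  change max (x i) 0 ∈ I i
  rcases max_choice (x i) 0 with h | h <;> rw [h]
  · exact hx i
  · exact (hI i).2.2.2

theorem le_coordPos {n : ℕ} (x : E n) : CoordLE x (coordPos x) := fun i => le_max_left (x i) 0

section FrankWolfe

variable {n : ℕ} {β G D : ℝ} {I : Fin n → Set ℝ}

theorem topCorner_nonneg (hI : Admissible I) : CoordLE 0 (topCorner I) :=
  le_topCorner hI (zero_mem_box hI)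

/-- The gradient at `x` bounds the gap to the optimum up to the loss caused by the negative
coordinates of `x`. -/
theorem val_topCorner_sub_le (hI : Admissible I) (hβ : 0 ≤ β) (f : Payoff (box I) β G) {x : E n}
    (hx : x ∈ box I) :
    f.val (topCorner I) - f.val (coordPos x) ≤ inner ℝ (f.grad x) (topCorner I) := by
  have hX := convex_box hI
  have hxp := coordPos_mem hI hx
  have h1 := f.val_sub_le hX hxp (topCorner_mem hI) (le_topCorner hI hxp)
  have hd : CoordLE 0 (topCorner I - coordPos x) := fun i => by
    simpa using le_topCorner hI hxp i
  have h2 := inner_le_inner_of_coordLE (f.drSubmodular _ hx _ hxp (le_coordPos x)) hd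
  have h3 := f.inner_grad_sub_nonneg hI hβ hx hxp (zero_mem_box hI)
    fun i => le_max_right (x i) 0
  rw [sub_zero] at h3
  rw [inner_sub_right (f.grad x)] at h2
  linarith

/-- From `v ≤ u` the new positive part is at most `x⁺ + u / K`, which stays in the box because `x ≤
(k / K) u`. Monotonicity, concavity and `∇f(x⁺) ≤ ∇f(x)` then bound the gain of `x⁺` by the quantity
that the gain of `x` attains up to error. -/
theorem val_coordPos_step (hI : Admissible I) (f : Payoff (box I) β G) {K k : ℕ} (hk : k < K)
    {x v : E n} (hx : x ∈ box I) (hxu : ∀ i, x i ≤ (k : ℝ) / K * topCorner I i) (hv : v ∈ box I)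
    (hx' : x + (1 / (K : ℝ)) • v ∈ box I) :
    f.val (coordPos (x + (1 / (K : ℝ)) • v)) - f.val (coordPos x) ≤
      1 / K * inner ℝ (f.grad x) (topCorner I) := by
  have hX := convex_box hI
  have hK : (0 : ℝ) < K := by exact_mod_cast (Nat.zero_le k).trans_lt hk
  have hxp := coordPos_mem hI hx
  set y : E n := coordPos x + (1 / (K : ℝ)) • topCorner I with hy
  have hu : ∀ i, 0 ≤ topCorner I i := topCorner_nonneg hI
  have hyi : ∀ i, y i = max (x i) 0 + 1 / K * topCorner I i := fun i => rfl
  have hyX : y ∈ box I := by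
    intro i
    refine (hI i).2.1.ordConnected.out (hI i).2.2.2 (topCorner_mem hI i) ⟨?_, ?_⟩
    · rw [hyi]
      have := hu i
      have := le_max_right (x i) 0
      positivity
    · rw [hyi]
      have h1 : max (x i) 0 ≤ (k : ℝ) / K * topCorner I i := by
        refine max_le (hxu i) ?_
        have := hu i
        positivity
      have h2 : (k : ℝ) / K + 1 / K ≤ 1 := by
        rw [← add_div, div_le_one hK]
        exact_mod_cast hk
      nlinarith [hu i]
  have h1 : f.val (coordPos (x + (1 / (K : ℝ)) • v)) ≤ f.val y := by
    refine f.monotone _ (coordPos_mem hI hx') _ hyX fun i => ?_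
    change max (x i + 1 / K * v i) 0 ≤ max (x i) 0 + 1 / K * topCorner I i
    have h2 : 1 / (K : ℝ) * v i ≤ 1 / K * topCorner I i :=
      mul_le_mul_of_nonneg_left (le_topCorner hI hv i) (by positivity)
    have h3 : 0 ≤ 1 / (K : ℝ) * topCorner I i := mul_nonneg (by positivity) (hu i)
    refine max_le ?_ ?_
    · have := le_max_left (x i) 0
      linarith
    · have := le_max_right (x i) 0
      linarith
  have hle : CoordLE (coordPos x) y := fun i => by
    rw [hyi]
    change max (x i) 0 ≤ _
    have h3 : 0 ≤ 1 / (K : ℝ) * topCorner I i := mul_nonneg (by positivity) (hu i)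
    linarith
  have h4 := f.val_sub_le hX hxp hyX hle
  rw [hy, add_sub_cancel_left, inner_smul_right] at h4
  have h5 := inner_le_inner_of_coordLE (f.drSubmodular _ hx _ hxp (le_coordPos x))
    (topCorner_nonneg hI)
  have h6 : 1 / (K : ℝ) * inner ℝ (f.grad (coordPos x)) (topCorner I)
      ≤ 1 / K * inner ℝ (f.grad x) (topCorner I) :=
    mul_le_mul_of_nonneg_left h5 (by positivity)
  linarith

/-- One round of the algorithm: the `(1 - 1/e)`-gap is at most twice the average of the
instantaneous regrets of the learners plus a discretization error. -/
theorem frankWolfe_gap (hI : Admissible I) (hβ : 0 ≤ β) (hD : ∀ x ∈ box I, ‖x‖ ≤ D)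
    (f : Payoff (box I) β G) {K : ℕ} (hK : 0 < K) {v : ℕ → E n} (hv : ∀ i, v i ∈ box I)
    {x : ℕ → E n} (hx : ∀ k, x k = (1 / (K : ℝ)) • ∑ i ∈ Finset.range k, v i) :
    (1 - 1 / Real.exp 1) * f.val (topCorner I) - f.val (x K) ≤
      2 * (1 / K * ∑ k ∈ Finset.range K, inner ℝ (f.grad (x k)) (topCorner I - v k)
        + β * D ^ 2 / K) := by
  have hX := convex_box hI
  have hK' : (0 : ℝ) < K := by exact_mod_cast hK
  have hK1 : (1 : ℝ) ≤ K := by exact_mod_cast hK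
  set u := topCorner I with hu
  have huX : u ∈ box I := topCorner_mem hI
  have hxX : ∀ k ≤ K, x k ∈ box I := fun k hk => by
    rw [hx]
    exact partialAverage_mem hX (zero_mem_box hI) hk fun i _ => hv i
  have hstep : ∀ k, x (k + 1) = x k + (1 / (K : ℝ)) • v k := fun k => by
    rw [hx, hx, Finset.sum_range_succ, smul_add]
  have hxu : ∀ k i, x k i ≤ (k : ℝ) / K * u i := by
    intro k i
    induction k with
    | zero => simp [hx]
    | succ k ih =>
      rw [hstep]
      change x k i + 1 / K * v k i ≤ _
      have h2 : 1 / (K : ℝ) * v k i ≤ 1 / K * u i :=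
        mul_le_mul_of_nonneg_left (le_topCorner hI (hv k) i) (by positivity)
      have h3 : ((k + 1 : ℕ) : ℝ) / K * u i = (k : ℝ) / K * u i + 1 / K * u i := by
        push_cast
        ring
      linarith
  set ρ : ℕ → ℝ := fun k => inner ℝ (f.grad (x k)) (u - v k) with hρ
  set c : ℝ := β * D ^ 2 with hc
  have hc0 : 0 ≤ c := by positivity
  have hρ0 : ∀ k ≤ K, 0 ≤ ρ k := fun k hk =>
    f.inner_grad_sub_nonneg hI hβ (hxX k hk) huX (hv k) (le_topCorner hI (hv k))
  set err : ℕ → ℝ := fun k => 1 / K * ∑ j ∈ Finset.range k, ρ j + k * (c / K ^ 2) with herr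
  have herr_succ : ∀ k, err (k + 1) = err k + (ρ k / K + c / K ^ 2) := fun k => by
    simp only [herr, Finset.sum_range_succ]
    push_cast
    ring
  have herr0 : ∀ k ≤ K, 0 ≤ err k := fun k hk => by
    simp only [herr]
    have : 0 ≤ ∑ j ∈ Finset.range k, ρ j :=
      Finset.sum_nonneg fun j hj => hρ0 j ((Finset.mem_range.1 hj).le.trans hk)
    positivity
  have hgain : ∀ k < K, 1 / K * inner ℝ (f.grad (x k)) u - (ρ k / K + c / K ^ 2)
      ≤ f.val (x (k + 1)) - f.val (x k) := by
    intro k hk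
    have h1 := f.le_val_sub hX hβ (hxX k hk.le) (hxX (k + 1) hk)
    rw [hstep, add_sub_cancel_left, inner_smul_right, norm_smul, mul_pow] at h1
    rw [← hstep] at h1
    have h2 : ‖v k‖ ^ 2 ≤ D ^ 2 := pow_le_pow_left₀ (norm_nonneg _) (hD _ (hv k)) 2
    have h3 : β * (‖1 / (K : ℝ)‖ ^ 2 * ‖v k‖ ^ 2) ≤ c / K ^ 2 := by
      rw [hc, Real.norm_eq_abs, sq_abs]
      calc β * ((1 / (K : ℝ)) ^ 2 * ‖v k‖ ^ 2) ≤ β * ((1 / (K : ℝ)) ^ 2 * D ^ 2) := by gcongr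
        _ = _ := by ring
    have h4 : ρ k / K = 1 / K * inner ℝ (f.grad (x k)) u
        - 1 / K * inner ℝ (f.grad (x k)) (v k) := by
      simp only [hρ]
      rw [inner_sub_right]
      ring
    linarith
  -- In each step `x⁺` gains at most `1 / K * ⟪∇f(x), u⟫` and `x` at least this minus the step
  -- error, so the deficit is at most the accumulated error.
  have hdef : ∀ k ≤ K, f.val (coordPos (x k)) - f.val (x k) ≤ err k := by
    intro k
    induction k with
    | zero =>
      intro _
      have h0 : coordPos (x 0) = x 0 := by
        ext i
        simp [coordPos, hx]
      simp [h0, herr]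
    | succ k ih =>
      intro hk
      have h1 := val_coordPos_step hI f hk (hxX k (by omega)) (hxu k) (hv k)
        (by rw [← hstep]; exact hxX _ hk)
      rw [← hstep] at h1
      have h2 := hgain k hk
      have h3 := ih (by omega)
      rw [herr_succ]
      linarith
  have hmono : ∀ k ≤ K, err k ≤ err K := by
    intro k hk
    simp only [herr]
    have h1 : ∑ j ∈ Finset.range k, ρ j ≤ ∑ j ∈ Finset.range K, ρ j :=
      Finset.sum_le_sum_of_subset_of_nonneg (Finset.range_mono hk)
        fun j hj _ => hρ0 j (Finset.mem_range.1 hj).le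
    gcongr
  -- `k / K * err K` collects the deficits and `err k` the step errors. At `k = K` both equal `err
  -- K`, whence the factor `2`.
  have hrec : ∀ k ≤ K, f.val u - f.val (x k) ≤
      (1 - 1 / (K : ℝ)) ^ k * f.val u + (k / K * err K + err k) := by
    intro k
    induction k with
    | zero =>
      intro _
      have := (f.mem_unit _ (hxX 0 (Nat.zero_le _))).1
      simp [herr]
      linarith
    | succ k ih =>
      intro hk
      have hkK : k ≤ K := by omega
      have h1 := ih hkK
      have h2 := hgain k hk
      have h3 := val_topCorner_sub_le hI hβ f (hxX k hkK)
      have h4 := hdef k hkK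
      have h5 := hmono k hkK
      have hq : 0 ≤ 1 - 1 / (K : ℝ) := by
        rw [sub_nonneg, div_le_one hK']
        exact hK1
      have hq1 : 1 - 1 / (K : ℝ) ≤ 1 := by
        have : 0 ≤ 1 / (K : ℝ) := by positivity
        linarith
      have h6 : f.val u - f.val (x (k + 1)) ≤ (1 - 1 / (K : ℝ)) * (f.val u - f.val (x k))
          + 1 / K * err K + (ρ k / K + c / K ^ 2) := by
        have h7 : 1 / (K : ℝ) * (f.val u - f.val (x k) - err K)
            ≤ 1 / K * inner ℝ (f.grad (x k)) u :=
          mul_le_mul_of_nonneg_left (by linarith) (by positivity)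
        linarith
      have h8 : (1 - 1 / (K : ℝ)) * (f.val u - f.val (x k)) ≤
          (1 - 1 / (K : ℝ)) * ((1 - 1 / (K : ℝ)) ^ k * f.val u + (k / K * err K + err k)) :=
        mul_le_mul_of_nonneg_left h1 hq
      have h9 : 0 ≤ k / K * err K + err k := by
        have := herr0 K le_rfl
        have := herr0 k hkK
        positivity
      have h10 : (1 - 1 / (K : ℝ)) * (k / K * err K + err k) ≤ k / K * err K + err k :=
        mul_le_of_le_one_left h9 hq1
      have h11 : ((k + 1 : ℕ) : ℝ) / K * err K = k / K * err K + 1 / K * err K := by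
        push_cast
        ring
      rw [herr_succ, pow_succ', h11]
      linarith
  have hfin := hrec K le_rfl
  have hpow : (1 - 1 / (K : ℝ)) ^ K ≤ 1 / Real.exp 1 := by
    rw [one_div (Real.exp 1), ← Real.exp_neg]
    exact Real.one_sub_div_pow_le_exp_neg hK1
  have h12 := mul_le_mul_of_nonneg_right hpow (f.mem_unit u huX).1
  rw [div_self hK'.ne', one_mul] at hfin
  have h13 : err K = 1 / K * ∑ k ∈ Finset.range K, ρ k + c / K := by
    simp only [herr]
    field_simp
  rw [← h13]
  linarith

end FrankWolfe

/-! ### The expected tree noise -/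

/-- Sum of the norms of the noise vectors that enter the private version of the `t`-th partial
sum. -/
def treeNoiseBound {n T : ℕ} (noise : Fin (levels T) → Fin T → E n) (t : ℕ) : ℝ :=
  ∑ i : Fin (levels T), ∑ j : Fin T,
    if t.testBit i = true ∧ t / 2 ^ (i : ℕ) = (j : ℕ) + 1 then ‖noise i j‖ else 0

theorem norm_treeNoise_le {n T : ℕ} (noise : Fin (levels T) → Fin T → E n) (t : ℕ) :
    ‖treeNoise noise t‖ ≤ treeNoiseBound noise t := by
  rw [treeNoise_eq, treeNoiseBound]
  refine (norm_sum_le _ _).trans (Finset.sum_le_sum fun i _ => (norm_sum_le _ _).trans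
    (Finset.sum_le_sum fun j _ => ?_))
  split_ifs <;> simp

section TreeNoise

variable {n T : ℕ} {G ε : ℝ}

theorem integrable_norm_learnerNoise (hT : 2 ≤ T) (hG : 0 < G) (hε : 0 < ε) {k : ℕ}
    (hk : k < numLearners T) (i : Fin (levels T)) (j : Fin T) :
    Integrable (fun ω : Noise n T => ‖learnerNoise ω k i j‖) (noiseMeasure n T G ε) := by
  have hs := learnerScale_pos hT hG hε
  have := isProbabilityMeasure_radialNoise n hs
  simp only [learnerNoise, hk, dif_pos]
  exact integrable_comp_eval (μ := fun _ : Fin (numLearners T) × Fin (levels T) × Fin T =>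
    radialNoise n (learnerScale T G ε)) (integrable_norm_radialNoise n hs)

theorem integral_norm_learnerNoise (hT : 2 ≤ T) (hG : 0 < G) (hε : 0 < ε) {k : ℕ}
    (hk : k < numLearners T) (i : Fin (levels T)) (j : Fin T) :
    ∫ ω : Noise n T, ‖learnerNoise ω k i j‖ ∂(noiseMeasure n T G ε) =
      learnerScale T G ε * radialMean n := by
  have hs := learnerScale_pos hT hG hε
  have := isProbabilityMeasure_radialNoise n hs
  simp only [learnerNoise, hk, dif_pos]
  rw [← integral_norm_radialNoise n hs]
  exact integral_comp_eval (μ := fun _ : Fin (numLearners T) × Fin (levels T) × Fin T =>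
    radialNoise n (learnerScale T G ε)) (f := fun b => ‖b‖)
    (integrable_norm_radialNoise n hs).aestronglyMeasurable

theorem integrable_ite_norm_learnerNoise (hT : 2 ≤ T) (hG : 0 < G) (hε : 0 < ε) {k : ℕ}
    (hk : k < numLearners T) (i : Fin (levels T)) (j : Fin T) (p : Prop) [Decidable p] :
    Integrable (fun ω : Noise n T => if p then ‖learnerNoise ω k i j‖ else 0)
      (noiseMeasure n T G ε) := by
  split_ifs
  · exact integrable_norm_learnerNoise hT hG hε hk i j
  · exact integrable_zero _ _ _

theorem integrable_treeNoiseBound (hT : 2 ≤ T) (hG : 0 < G) (hε : 0 < ε) {k : ℕ}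
    (hk : k < numLearners T) (t : ℕ) :
    Integrable (fun ω : Noise n T => treeNoiseBound (learnerNoise ω k) t)
      (noiseMeasure n T G ε) :=
  integrable_finsetSum _ fun i _ => integrable_finsetSum _ fun j _ =>
    integrable_ite_norm_learnerNoise hT hG hε hk i j _

/-- Each level contributes at most one noise vector; cancellation between independent vectors is not
exploited. -/
theorem integral_treeNoiseBound_le (hT : 2 ≤ T) (hG : 0 < G) (hε : 0 < ε) {k : ℕ}
    (hk : k < numLearners T) (t : ℕ) :
    ∫ ω : Noise n T, treeNoiseBound (learnerNoise ω k) t ∂(noiseMeasure n T G ε) ≤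
      levels T * (learnerScale T G ε * radialMean n) := by
  have hc : 0 ≤ learnerScale T G ε * radialMean n :=
    mul_nonneg (learnerScale_pos hT hG hε).le (radialMean_nonneg n)
  unfold treeNoiseBound
  rw [integral_finsetSum _ fun i _ => integrable_finsetSum _ fun j _ =>
    integrable_ite_norm_learnerNoise hT hG hε hk i j _]
  have hi : ∀ i : Fin (levels T), ∫ ω : Noise n T, (∑ j : Fin T,
      if t.testBit i = true ∧ t / 2 ^ (i : ℕ) = (j : ℕ) + 1 then ‖learnerNoise ω k i j‖ else 0)
        ∂(noiseMeasure n T G ε) ≤ learnerScale T G ε * radialMean n := by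
    intro i
    rw [integral_finsetSum _ fun j _ => integrable_ite_norm_learnerNoise hT hG hε hk i j _]
    have hj : ∀ j : Fin T, ∫ ω : Noise n T,
        (if t.testBit i = true ∧ t / 2 ^ (i : ℕ) = (j : ℕ) + 1 then ‖learnerNoise ω k i j‖ else 0)
          ∂(noiseMeasure n T G ε) =
        if t.testBit i = true ∧ t / 2 ^ (i : ℕ) = (j : ℕ) + 1 then
          learnerScale T G ε * radialMean n else 0 := by
      intro j
      split_ifs
      · exact integral_norm_learnerNoise hT hG hε hk i j
      · simp
    simp only [hj]
    rw [← Finset.sum_filter, Finset.sum_const, nsmul_eq_mul]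
    refine mul_le_of_le_one_left hc ?_
    rw [Nat.cast_le_one, Finset.card_le_one]
    intro a ha b hb
    have ha' := (Finset.mem_filter.1 ha).2.2
    have hb' := (Finset.mem_filter.1 hb).2.2
    exact Fin.ext (by omega)
  refine (Finset.sum_le_sum fun i _ => hi i).trans ?_
  simp

end TreeNoise

/-! ### Regret for fixed noise -/

section Regret

variable {n T : ℕ} {β G ε D : ℝ} {I : Fin n → Set ℝ} {init : ℕ → E n}

theorem regret_le_topCorner (hI : Admissible I) (F : Fin T → Payoff (box I) β G)
    (x : Fin T → E n) :
    regret F x ≤ ∑ t, ((1 - 1 / Real.exp 1) * (F t).val (topCorner I) - (F t).val (x t)) := by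
  have h1 : sSup ((fun y => ∑ t, (F t).val y) '' box I) ≤ ∑ t, (F t).val (topCorner I) := by
    refine csSup_le (Set.Nonempty.image _ ⟨0, zero_mem_box hI⟩) ?_
    rintro _ ⟨y, hy, rfl⟩
    exact Finset.sum_le_sum fun t _ =>
      (F t).monotone y hy _ (topCorner_mem hI) (le_topCorner hI hy)
  have h2 : 0 ≤ 1 - 1 / Real.exp 1 := by
    rw [sub_nonneg, div_le_one (Real.exp_pos 1)]
    exact Real.one_le_exp zero_le_one
  unfold regret
  rw [Finset.sum_sub_distrib, ← Finset.mul_sum]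
  exact sub_le_sub_right (mul_le_mul_of_nonneg_left h1 h2) _

/-- The comparator is the same corner in all rounds, so the sums over rounds and learners can be
exchanged, and each learner's regret bound applies. -/
theorem regret_play_le (hI : Admissible I) (hβ : 0 ≤ β) (hG : 0 ≤ G) (hT : 2 ≤ T)
    (hH : 0 < pftalReg n T (ε / (numLearners T : ℝ))) (hD : Metric.diam (box I) ≤ D)
    (hinit : ∀ k, init k ∈ box I) (F : Fin T → Payoff (box I) β G) (ω : Noise n T) :
    regret F (play ε init F ω) ≤ ∑ k ∈ Finset.range (numLearners T),
        2 / (numLearners T : ℝ) * (pftalReg n T (ε / (numLearners T : ℝ)) / 2 * D ^ 2 * T +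
          ∑ t ∈ Finset.range T, G / (pftalReg n T (ε / (numLearners T : ℝ)) * (t + 1 : ℕ)) *
            (G + treeNoiseBound (learnerNoise ω k) t))
      + 2 * (β * D ^ 2 * (T / (numLearners T : ℝ))) := by
  set K := numLearners T with hKdef
  set H := pftalReg n T (ε / (K : ℝ)) with hHdef
  have hK : 0 < K := numLearners_pos hT
  refine (regret_le_topCorner hI F _).trans ?_
  have hround : ∀ t : Fin T, (1 - 1 / Real.exp 1) * (F t).val (topCorner I)
      - (F t).val (play ε init F ω t) ≤ ∑ k ∈ Finset.range K, 2 / (K : ℝ) *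
        inner ℝ (costVector ε init F ω k t) (direction ε init F ω k t - topCorner I)
        + 2 * (β * D ^ 2 / K) := by
    intro t
    have h := frankWolfe_gap hI hβ (fun x hx => (norm_le_diam_box hI hx).trans hD) (F t) hK
      (v := fun k => direction ε init F ω k t) (fun k => direction_mem hI hinit F ω k t)
      (x := fun k => queryPoint ε init F ω k t) (fun k => rfl)
    rw [play_eq]
    refine h.trans (le_of_eq ?_)
    rw [mul_add, Finset.mul_sum, Finset.mul_sum]
    congr 1
    refine Finset.sum_congr rfl fun k _ => ?_
    simp only [costVector, t.2, dif_pos]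
    rw [inner_neg_left, ← inner_neg_right, neg_sub]
    ring
  refine (Finset.sum_le_sum fun t _ => hround t).trans ?_
  rw [Finset.sum_add_distrib, Finset.sum_comm]
  have hlearner : ∀ k ∈ Finset.range K, ∑ t : Fin T, 2 / (K : ℝ) *
      inner ℝ (costVector ε init F ω k t) (direction ε init F ω k t - topCorner I) ≤
      2 / (K : ℝ) * (H / 2 * D ^ 2 * T + ∑ t ∈ Finset.range T, G / (H * (t + 1 : ℕ)) *
            (G + treeNoiseBound (learnerNoise ω k) t)) := by
    intro k hk
    have hkK : k ≤ K := (Finset.mem_range.1 hk).le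
    rw [← Finset.mul_sum]
    refine mul_le_mul_of_nonneg_left ?_ (by positivity)
    have h := pftal_regret (isCompact_box hI) (convex_box hI) hH (hinit k) (learnerNoise ω k)
      (g := fun t => costVector ε init F ω k t) (norm_costVector_le hI hinit hG F ω hkK)
      (fun x hx y hy => (dist_le_diam_box hI hx hy).trans hD) (topCorner_mem hI)
    rw [← direction_eq] at h
    rw [Finset.sum_range] at h
    refine h.trans (add_le_add le_rfl (Finset.sum_le_sum fun t _ => ?_))
    rw [div_mul_eq_mul_div]
    have := norm_treeNoise_le (learnerNoise ω k) t
    gcongr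
  refine add_le_add (Finset.sum_le_sum hlearner) (le_of_eq ?_)
  rw [Finset.sum_const, Finset.card_univ, Fintype.card_fin, nsmul_eq_mul]
  ring

theorem integrable_regret (hT : 2 ≤ T) (hG : 0 < G) (hε : 0 < ε) (hI : Admissible I)
    (hinit : ∀ k, init k ∈ box I) (F : Fin T → Payoff (box I) β G) :
    Integrable (fun ω => regret F (play ε init F ω)) (noiseMeasure n T G ε) := by
  have := isProbabilityMeasure_noiseMeasure n hT hG hε
  unfold regret
  refine (integrable_const _).sub (integrable_finsetSum _ fun t _ => ?_)
  refine Integrable.of_bound (measurable_val_play hT hε hI hinit F t (F t)).aestronglyMeasurable 1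
    (Filter.Eventually.of_forall fun ω => ?_)
  have h : play ε init F ω t ∈ box I := by
    rw [play_eq]
    exact queryPoint_mem hI hinit F ω le_rfl t
  have h2 := (F t).mem_unit _ h
  rw [Real.norm_of_nonneg h2.1]
  exact h2.2

theorem sum_inv_succ_le (T : ℕ) :
    ∑ t ∈ Finset.range T, ((t + 1 : ℕ) : ℝ)⁻¹ ≤ 1 + Real.log T := by
  have h := harmonic_le_one_add_log T
  simpa [harmonic] using h

theorem integral_regret_le (hI : Admissible I) (hβ : 0 ≤ β) (hG : 0 < G) (hT : 2 ≤ T)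
    (hε : 0 < ε) (hH : 0 < pftalReg n T (ε / (numLearners T : ℝ)))
    (hD : Metric.diam (box I) ≤ D)
    (hinit : ∀ k, init k ∈ box I) (F : Fin T → Payoff (box I) β G) :
    ∫ ω, regret F (play ε init F ω) ∂(noiseMeasure n T G ε) ≤
      2 * (pftalReg n T (ε / (numLearners T : ℝ)) / 2 * D ^ 2 * T +
        G / pftalReg n T (ε / (numLearners T : ℝ)) *
          (G + levels T * (learnerScale T G ε * radialMean n)) * (1 + Real.log T)
        + β * D ^ 2 * (T / (numLearners T : ℝ))) := by
  have := isProbabilityMeasure_noiseMeasure n hT hG hε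
  set K := numLearners T with hKdef
  set H := pftalReg n T (ε / (K : ℝ)) with hHdef
  set N := levels T * (learnerScale T G ε * radialMean n) with hN
  have hN0 : 0 ≤ N := mul_nonneg (Nat.cast_nonneg _)
    (mul_nonneg (learnerScale_pos hT hG hε).le (radialMean_nonneg n))
  have hK : (0 : ℝ) < K := by exact_mod_cast numLearners_pos hT
  have hint1 : ∀ k < K, ∀ t : ℕ, Integrable (fun ω : Noise n T => G / (H * (t + 1 : ℕ)) *
      (G + treeNoiseBound (learnerNoise ω k) t)) (noiseMeasure n T G ε) := fun k hk t =>
    ((integrable_const G).add (integrable_treeNoiseBound hT hG hε hk t)).const_mul _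
  have hint2 : ∀ k < K, Integrable (fun ω : Noise n T => 2 / (K : ℝ) * (H / 2 * D ^ 2 * T +
      ∑ t ∈ Finset.range T, G / (H * (t + 1 : ℕ)) *
        (G + treeNoiseBound (learnerNoise ω k) t))) (noiseMeasure n T G ε) := fun k hk =>
    ((integrable_const _).add (integrable_finsetSum _ fun t _ => hint1 k hk t)).const_mul _
  have hint3 : Integrable (fun ω : Noise n T => ∑ k ∈ Finset.range K,
      2 / (K : ℝ) * (H / 2 * D ^ 2 * T + ∑ t ∈ Finset.range T, G / (H * (t + 1 : ℕ)) *
        (G + treeNoiseBound (learnerNoise ω k) t))) (noiseMeasure n T G ε) :=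
    integrable_finsetSum _ fun k hk => hint2 k (Finset.mem_range.1 hk)
  refine (integral_mono (integrable_regret hT hG hε hI hinit F)
    (hint3.add (integrable_const (2 * (β * D ^ 2 * (T / (K : ℝ))))))
    fun ω => regret_play_le hI hβ hG.le hT hH hD hinit F ω).trans ?_
  rw [integral_add' hint3 (integrable_const _), integral_const, probReal_univ, one_smul,
    integral_finsetSum _ fun k hk => hint2 k (Finset.mem_range.1 hk)]
  have hk : ∀ k ∈ Finset.range K, ∫ ω : Noise n T, 2 / (K : ℝ) * (H / 2 * D ^ 2 * T +
      ∑ t ∈ Finset.range T, G / (H * (t + 1 : ℕ)) *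
        (G + treeNoiseBound (learnerNoise ω k) t)) ∂(noiseMeasure n T G ε) ≤
      2 / (K : ℝ) * (H / 2 * D ^ 2 * T + G / H * (G + N) * (1 + Real.log T)) := by
    intro k hk
    have hk' := Finset.mem_range.1 hk
    rw [integral_const_mul, integral_add (integrable_const _)
      (integrable_finsetSum _ fun t _ => hint1 k hk' t), integral_const, probReal_univ, one_smul,
      integral_finsetSum _ fun t _ => hint1 k hk' t]
    refine mul_le_mul_of_nonneg_left (add_le_add le_rfl ?_) (by positivity)
    have ht : ∀ t ∈ Finset.range T, ∫ ω : Noise n T, G / (H * (t + 1 : ℕ)) *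
        (G + treeNoiseBound (learnerNoise ω k) t) ∂(noiseMeasure n T G ε) ≤
        G / H * (G + N) * ((t + 1 : ℕ) : ℝ)⁻¹ := by
      intro t _
      rw [integral_const_mul, integral_add (integrable_const _)
        (integrable_treeNoiseBound hT hG hε hk' t), integral_const, probReal_univ, one_smul]
      have h := integral_treeNoiseBound_le (n := n) hT hG hε hk' t
      calc G / (H * (t + 1 : ℕ)) * (G + ∫ ω : Noise n T, treeNoiseBound (learnerNoise ω k) t
            ∂(noiseMeasure n T G ε)) ≤ G / (H * (t + 1 : ℕ)) * (G + N) := by gcongr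
        _ = _ := by
          rw [div_mul_eq_div_div]
          ring
    refine (Finset.sum_le_sum ht).trans ?_
    rw [← Finset.mul_sum]
    exact mul_le_mul_of_nonneg_left (sum_inv_succ_le T) (by positivity)
  refine (add_le_add (Finset.sum_le_sum hk) le_rfl).trans (le_of_eq ?_)
  have hKK : (K : ℝ) * (2 / K) = 2 := mul_div_cancel₀ 2 hK.ne'
  rw [Finset.sum_const, Finset.card_range, nsmul_eq_mul, ← mul_assoc, hKK]
  ring

end Regret

/-! ### Growth of the parameters -/

section Growth

variable {T : ℕ}

theorem point_six_nine_le_log (hT : 2 ≤ T) : 0.69 ≤ Real.log T := by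
  have h1 : Real.log 2 ≤ Real.log T := Real.log_le_log two_pos (by exact_mod_cast hT)
  have := Real.log_two_gt_d9
  linarith

/-- For `T ≥ 2` the extra level at most doubles `Nat.log 2 T`, and `2 / log 2 < 3`. -/
theorem levels_le (hT : 2 ≤ T) : (levels T : ℝ) ≤ 3 * Real.log T := by
  have h1 : ((2 : ℕ) : ℝ) ^ Nat.log 2 T ≤ T := by
    exact_mod_cast Nat.pow_log_le_self 2 (by omega : T ≠ 0)
  have h2 := Real.log_le_log (by positivity) h1
  rw [Real.log_pow] at h2
  have h3 := Real.log_two_gt_d9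
  have h4 : (levels T : ℝ) = Nat.log 2 T + 1 := by simp [levels]
  have h5 : (1 : ℝ) ≤ Nat.log 2 T := by
    exact_mod_cast Nat.log_pos one_lt_two hT
  have h6 : Real.log 2 ≤ Real.log T := Real.log_le_log two_pos (by exact_mod_cast hT)
  rw [h4]
  push_cast at h2
  nlinarith

/-- `T ^ (1 / 4)`. -/
def quarticRoot (T : ℕ) : ℝ := (T : ℝ) ^ (1 / 4 : ℝ)

theorem one_le_quarticRoot (hT : 2 ≤ T) : 1 ≤ quarticRoot T :=
  Real.one_le_rpow (by exact_mod_cast (by omega : 1 ≤ T)) (by norm_num)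

theorem quarticRoot_pow_four (T : ℕ) : quarticRoot T ^ 4 = T := by
  unfold quarticRoot
  rw [← Real.rpow_natCast, ← Real.rpow_mul (Nat.cast_nonneg _)]
  norm_num

theorem rpow_three_quarters (T : ℕ) : (T : ℝ) ^ (3 / 4 : ℝ) = quarticRoot T ^ 3 := by
  unfold quarticRoot
  rw [← Real.rpow_natCast, ← Real.rpow_mul (Nat.cast_nonneg _)]
  norm_num

theorem sqrt_eq_quarticRoot_sq (T : ℕ) (hT : 2 ≤ T) : √(T : ℝ) = quarticRoot T ^ 2 := by
  have := one_le_quarticRoot hT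
  rw [← quarticRoot_pow_four T, show quarticRoot T ^ 4 = (quarticRoot T ^ 2) ^ 2 by ring,
    Real.sqrt_sq (by positivity)]

/-- `(log T) ^ (5 / 4)`. -/
def logRoot (T : ℕ) : ℝ := √(Real.log T ^ (2.5 : ℝ))

theorem logRoot_sq (hT : 2 ≤ T) : logRoot T ^ 2 = Real.log T ^ (2.5 : ℝ) := by
  have := point_six_nine_le_log hT
  have h0 : 0 ≤ Real.log T := by linarith
  exact Real.sq_sqrt (Real.rpow_nonneg h0 _)

theorem half_log_le_logRoot (hT : 2 ≤ T) : Real.log T / 2 ≤ logRoot T := by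
  have h := point_six_nine_le_log hT
  have h0 : 0 < Real.log T := by linarith
  refine Real.le_sqrt_of_sq_le ?_
  have h1 : Real.log T ^ (2.5 : ℝ) = Real.log T ^ 2 * √(Real.log T) := by
    rw [Real.sqrt_eq_rpow, ← Real.rpow_natCast, ← Real.rpow_add h0]
    norm_num
  have h2 : 1 / 4 ≤ √(Real.log T) := Real.le_sqrt_of_sq_le (by norm_num at h ⊢; linarith)
  rw [h1]
  nlinarith [sq_nonneg (Real.log T)]

/-- `log p ≤ p` for `p = T ^ (1 / 12)`, cubed; `1728 = 12 ^ 3`. -/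
theorem log_pow_three_le (hT : 2 ≤ T) : Real.log T ^ 3 ≤ 1728 * quarticRoot T := by
  have h0 : (0 : ℝ) < T := by positivity
  have hl : 0 ≤ Real.log T := by have := point_six_nine_le_log hT; linarith
  set p : ℝ := (T : ℝ) ^ (1 / 12 : ℝ) with hp
  have hp0 : 0 < p := by positivity
  have h1 : Real.log T = 12 * Real.log p := by
    rw [hp, Real.log_rpow h0]
    ring
  have h2 : Real.log p ≤ p := (Real.log_le_sub_one_of_pos hp0).trans (by linarith)
  have h3 : p ^ 3 = quarticRoot T := by
    unfold quarticRoot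
    rw [hp, ← Real.rpow_natCast, ← Real.rpow_mul h0.le]
    norm_num
  calc Real.log T ^ 3 ≤ (12 * p) ^ 3 := pow_le_pow_left₀ hl (by linarith) 3
    _ = 1728 * quarticRoot T := by rw [← h3]; ring

theorem sqrt_ratio_eq (hT : 2 ≤ T) :
    √(√(T : ℝ) / Real.log T ^ (2.5 : ℝ)) = quarticRoot T / logRoot T := by
  have hq := one_le_quarticRoot hT
  rw [sqrt_eq_quarticRoot_sq T hT, Real.sqrt_div (by positivity), Real.sqrt_sq (by positivity),
    logRoot]

theorem le_numLearners (hT : 2 ≤ T) : quarticRoot T / logRoot T ≤ numLearners T := by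
  rw [← sqrt_ratio_eq hT]
  exact Nat.le_ceil _

theorem numLearners_le (hT : 2 ≤ T) : (numLearners T : ℝ) ≤ 5 * quarticRoot T := by
  have hq := one_le_quarticRoot hT
  have hl := point_six_nine_le_log hT
  have hm := half_log_le_logRoot hT
  have h1 : (numLearners T : ℝ) < quarticRoot T / logRoot T + 1 := by
    rw [← sqrt_ratio_eq hT]
    exact Nat.ceil_lt_add_one (Real.sqrt_nonneg _)
  have hm0 : 1 / 4 ≤ logRoot T := by norm_num at hl ⊢; linarith
  have h2 : quarticRoot T / logRoot T ≤ 4 * quarticRoot T := by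
    rw [div_le_iff₀ (by linarith)]
    nlinarith
  linarith

end Growth

/-! ### Comparison of the error terms with the regret rate. -/

theorem le_of_sq_le_mul_sq {a b c : ℝ} (hc : 0 ≤ c) (hb : 0 ≤ b) (h : a ^ 2 ≤ c * b ^ 2) :
    a ≤ √c * b := by
  refine (Real.le_sqrt_of_sq_le h).trans (le_of_eq ?_)
  rw [Real.sqrt_mul hc, Real.sqrt_sq hb]

section RegretRate

variable {n T : ℕ} {ε ε₀ : ℝ}

/-- The regret rate `T ^ (3 / 4) * (log T) ^ (5 / 4) / ε`. -/
def rate (T : ℕ) (ε : ℝ) : ℝ := quarticRoot T ^ 3 * logRoot T / ε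

theorem rate_eq (T : ℕ) (ε : ℝ) :
    (T : ℝ) ^ (3 / 4 : ℝ) * √(Real.log T ^ (2.5 : ℝ)) / ε = rate T ε := by
  rw [rate, rpow_three_quarters, logRoot]

theorem pftalReg_sq (n : ℕ) (hT : 2 ≤ T) (hε : 0 < ε) :
    pftalReg n T (ε / (numLearners T : ℝ)) ^ 2 =
      n * logRoot T ^ 2 * numLearners T / (ε * quarticRoot T ^ 4) := by
  have hK : (0 : ℝ) < numLearners T := by exact_mod_cast numLearners_pos hT
  have hl : 0 ≤ Real.log T := by have := point_six_nine_le_log hT; linarith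
  unfold pftalReg
  rw [Real.sq_sqrt (by positivity), logRoot_sq hT, quarticRoot_pow_four]
  field_simp

/-- With `q = T ^ (1 / 4)` and `m = logRoot T`, the square of the left side is `n m² K q⁴ / ε`; the
bound `K ≤ 5 q` leaves a spare factor `q`. -/
theorem pftalReg_mul_le (n : ℕ) (hT : 2 ≤ T) (hε : 0 < ε) (hε₀ : ε ≤ ε₀) :
    pftalReg n T (ε / (numLearners T : ℝ)) * T ≤ √(5 * n * ε₀) * rate T ε := by
  have hq := one_le_quarticRoot hT
  have hm : 0 ≤ logRoot T := Real.sqrt_nonneg _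
  have hK := numLearners_le hT
  have hε₀' : 0 ≤ ε₀ := hε.le.trans hε₀
  refine le_of_sq_le_mul_sq (by positivity)
    (by unfold rate; positivity) ?_
  rw [mul_pow, pftalReg_sq n hT hε, ← quarticRoot_pow_four T, rate]
  set q := quarticRoot T
  set m := logRoot T
  have h1 : n * m ^ 2 * numLearners T / (ε * q ^ 4) * (q ^ 4) ^ 2 =
      n * m ^ 2 * q ^ 4 * ε * numLearners T / ε ^ 2 := by
    have : q ≠ 0 := by positivity
    field_simp
  have h2 : 5 * n * ε₀ * (q ^ 3 * m / ε) ^ 2 = n * m ^ 2 * q ^ 4 * ε₀ * (5 * q ^ 2) / ε ^ 2 := by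
    field_simp
  rw [h1, h2]
  have h3 : (numLearners T : ℝ) ≤ 5 * q ^ 2 := by nlinarith
  gcongr

/-- This is the size of the tree noise term. By `K ≥ q / m` its square is at most `l⁶ q⁵ / (ε m)`.
One `l³` is paid by `1728 q`, the other by `8 m³`, and `13824 = 1728 * 8`. -/
theorem log_cube_div_pftalReg_le (hn : 0 < n) (hT : 2 ≤ T) (hε : 0 < ε) (hε₀ : ε ≤ ε₀) :
    Real.log T ^ 3 * quarticRoot T / (ε * pftalReg n T (ε / (numLearners T : ℝ))) ≤
      √(13824 * ε₀) * rate T ε := by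
  have hq := one_le_quarticRoot hT
  have hl := point_six_nine_le_log hT
  have hm := half_log_le_logRoot hT
  have hm0 : 0 < logRoot T := by norm_num at hl; linarith
  have hl0 : 0 ≤ Real.log T := by linarith
  have hK := le_numLearners hT
  have hlq := log_pow_three_le hT
  have hn1 : (1 : ℝ) ≤ n := by exact_mod_cast hn
  have hε₀' : 0 < ε₀ := hε.trans_le hε₀
  refine le_of_sq_le_mul_sq (by positivity) (by unfold rate; positivity) ?_
  rw [div_pow, mul_pow ε, pftalReg_sq n hT hε, rate]
  set q := quarticRoot T
  set m := logRoot T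
  set l := Real.log T
  have hq0 : 0 < q := by linarith
  have h1 : l ^ 3 ≤ 8 * m ^ 3 := by
    have := pow_le_pow_left₀ (by positivity) hm 3
    rw [div_pow] at this
    linarith
  have h2 : l ^ 6 ≤ 13824 * (q * m ^ 3) := by
    calc l ^ 6 = l ^ 3 * l ^ 3 := by ring
      _ ≤ (1728 * q) * (8 * m ^ 3) := mul_le_mul hlq h1 (by positivity) (by positivity)
      _ = _ := by ring
  have h3 : ε * m / q ^ 3 ≤ ε ^ 2 * (n * m ^ 2 * numLearners T / (ε * q ^ 4)) := by
    calc ε * m / q ^ 3 = ε ^ 2 * (1 * m ^ 2 * (q / m) / (ε * q ^ 4)) := by field_simp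
      _ ≤ _ := by gcongr
  calc (l ^ 3 * q) ^ 2 / (ε ^ 2 * (n * m ^ 2 * numLearners T / (ε * q ^ 4)))
      ≤ (l ^ 3 * q) ^ 2 / (ε * m / q ^ 3) :=
        div_le_div_of_nonneg_left (by positivity) (by positivity) h3
    _ = l ^ 6 * (ε * q ^ 5 / (ε ^ 2 * m)) := by field_simp
    _ ≤ 13824 * (q * m ^ 3) * (ε₀ * q ^ 5 / (ε ^ 2 * m)) := by gcongr
    _ = 13824 * ε₀ * (q ^ 3 * m / ε) ^ 2 := by field_simp

/-- The discretization error, the term for which the number of learners is tuned: `T / K ≤ q³ m`. -/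
theorem div_numLearners_le (hT : 2 ≤ T) (hε : 0 < ε) (hε₀ : ε ≤ ε₀) :
    (T : ℝ) / numLearners T ≤ ε₀ * rate T ε := by
  have hq := one_le_quarticRoot hT
  have hl := point_six_nine_le_log hT
  have hm := half_log_le_logRoot hT
  have hm0 : 0 < logRoot T := by norm_num at hl; linarith
  have hK := le_numLearners hT
  rw [rate, ← quarticRoot_pow_four T]
  set q := quarticRoot T
  set m := logRoot T
  have hq0 : 0 < q := by linarith
  calc q ^ 4 / numLearners T ≤ q ^ 4 / (q / m) :=
        div_le_div_of_nonneg_left (by positivity) (by positivity) hK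
    _ = ε * (q ^ 3 * m / ε) := by field_simp
    _ ≤ _ := by gcongr

theorem learner_overhead_le {G : ℝ} (hn : 0 < n) (hT : 2 ≤ T) (hG : 0 < G) (hε : 0 < ε)
    (hε₀ : ε ≤ ε₀) :
    G / pftalReg n T (ε / (numLearners T : ℝ)) *
        (G + levels T * (learnerScale T G ε * radialMean n)) * (1 + Real.log T) ≤
      3 * G ^ 2 * (4 * ε₀ + 90 * radialMean n) * (√(13824 * ε₀) * rate T ε) := by
  have hK0 : (0 : ℝ) < numLearners T := by exact_mod_cast numLearners_pos hT
  have hH := pftalReg_pos hn hT (div_pos hε hK0)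
  have hq := one_le_quarticRoot hT
  have hl := point_six_nine_le_log hT
  have hl0 : 0 ≤ Real.log T := by linarith
  have hK := numLearners_le hT
  have hL := levels_le hT
  have hM := radialMean_nonneg n
  have hε₀' : 0 < ε₀ := hε.trans_le hε₀
  have hmain := log_cube_div_pftalReg_le hn hT hε hε₀
  set q := quarticRoot T
  set l := Real.log T
  set H := pftalReg n T (ε / (numLearners T : ℝ))
  -- One factor `levels T` counts the blocks and one comes from the noise scale; `90 = 2 * 3 ^ 2 *
  -- 5`.
  have h1 : levels T * (learnerScale T G ε * radialMean n)
      ≤ 90 * G * radialMean n * (l ^ 2 * q / ε) := by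
    calc levels T * (learnerScale T G ε * radialMean n)
        = 2 * G * radialMean n * ((levels T : ℝ) ^ 2 * numLearners T / ε) := by
          unfold learnerScale noiseScale
          field_simp
      _ ≤ 2 * G * radialMean n * ((3 * l) ^ 2 * (5 * q) / ε) := by gcongr
      _ = _ := by ring
  have h2 : G ≤ 4 * ε₀ * G * (l ^ 2 * q / ε) := by
    have h3 : 1 ≤ 4 * (l ^ 2 * q) := by norm_num at hl; nlinarith
    have h4 : 1 ≤ 4 * ε₀ * (l ^ 2 * q / ε) := by
      rw [mul_div_assoc', le_div_iff₀ hε]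
      nlinarith
    calc G = G * 1 := (mul_one G).symm
      _ ≤ G * (4 * ε₀ * (l ^ 2 * q / ε)) := by gcongr
      _ = _ := by ring
  have h5 : 1 + l ≤ 3 * l := by norm_num at hl; linarith
  calc G / H * (G + levels T * (learnerScale T G ε * radialMean n)) * (1 + l)
      ≤ G / H * (4 * ε₀ * G * (l ^ 2 * q / ε) + 90 * G * radialMean n * (l ^ 2 * q / ε))
        * (3 * l) := by gcongr
    _ = 3 * G ^ 2 * (4 * ε₀ + 90 * radialMean n) * (l ^ 3 * q / (ε * H)) := by
        field_simp
    _ ≤ _ := by gcongr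

end RegretRate

/-! ### The regret bound in all dimensions and the main theorem. -/

theorem regret_nonpos_of_dim_zero {T : ℕ} {β G : ℝ} {I : Fin 0 → Set ℝ} (hI : Admissible I)
    (F : Fin T → Payoff (box I) β G) (x : Fin T → E 0) : regret F x ≤ 0 := by
  refine (regret_le_topCorner hI F x).trans (Finset.sum_nonpos fun t _ => ?_)
  rw [Subsingleton.elim (x t) (topCorner I)]
  have h1 := ((F t).mem_unit _ (topCorner_mem hI)).1
  have h2 : 0 ≤ 1 / Real.exp 1 * (F t).val (topCorner I) := by positivity
  linarith

theorem exists_regret_bound (n : ℕ) {β G : ℝ} (hβ : 0 ≤ β) (hG : 0 < G) (D ε₀ : ℝ) :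
    ∃ C : ℝ, ∀ T : ℕ, 2 ≤ T → ∀ ε : ℝ, 0 < ε → ε ≤ ε₀ →
      ∀ I : Fin n → Set ℝ, Admissible I → Metric.diam (box I) ≤ D →
      ∀ init : ℕ → E n, (∀ k, init k ∈ box I) → ∀ F : Fin T → Payoff (box I) β G,
        ∫ ω, regret F (play ε init F ω) ∂(noiseMeasure n T G ε) ≤ C * rate T ε := by
  refine ⟨2 * (D ^ 2 / 2 * √(5 * n * ε₀) +
    3 * G ^ 2 * (4 * ε₀ + 90 * radialMean n) * √(13824 * ε₀) + β * D ^ 2 * ε₀), ?_⟩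
  intro T hT ε hε hε₀ I hI hD init hinit F
  have hε₀' : 0 < ε₀ := hε.trans_le hε₀
  -- For `n = 0` the regularization vanishes and the general bound, which divides by it, does not
  -- apply.
  rcases Nat.eq_zero_or_pos n with rfl | hn
  · refine (integral_nonpos fun ω => regret_nonpos_of_dim_zero hI F _).trans ?_
    have hq := one_le_quarticRoot hT
    have hm : 0 ≤ logRoot T := Real.sqrt_nonneg _
    have hM := radialMean_nonneg 0
    unfold rate
    positivity
  · have hK0 : (0 : ℝ) < numLearners T := by exact_mod_cast numLearners_pos hT
    refine (integral_regret_le hI hβ hG hT hε (pftalReg_pos hn hT (div_pos hε hK0)) hD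
      hinit F).trans ?_
    have h1 := mul_le_mul_of_nonneg_left (pftalReg_mul_le n hT hε hε₀)
      (by positivity : 0 ≤ D ^ 2 / 2)
    have h2 := learner_overhead_le hn hT hG hε hε₀
    have h3 := mul_le_mul_of_nonneg_left (div_numLearners_le hT hε hε₀)
      (by positivity : 0 ≤ β * D ^ 2)
    linarith

end DROnline

end

theorem theorem7 (n : ℕ) (β G : ℝ) (hβ : 0 ≤ β) (hG : 0 < G) :
    (∀ T : ℕ, 2 ≤ T → ∀ ε : ℝ, 0 < ε →
      ∀ I : Fin n → Set ℝ, DROnline.Admissible I →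
      ∀ init : ℕ → DROnline.E n, (∀ k, init k ∈ DROnline.box I) →
        (∀ (F : Fin T → DROnline.Payoff (DROnline.box I) β G) (ω : DROnline.Noise n T) (t : Fin T),
          DROnline.play ε init F ω t ∈ DROnline.box I) ∧
        (∀ F : Fin T → DROnline.Payoff (DROnline.box I) β G,
          MeasureTheory.IsProbabilityMeasure (DROnline.outputLaw ε init F)) ∧
        DROnline.IsDP DROnline.Neighboring
          (fun F : Fin T → DROnline.Payoff (DROnline.box I) β G => DROnline.outputLaw ε init F)
          ε 0) ∧
    (∀ D ε₀ : ℝ, ∃ C : ℝ, ∀ T : ℕ, 2 ≤ T → ∀ ε : ℝ, 0 < ε → ε ≤ ε₀ →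
      ∀ I : Fin n → Set ℝ, DROnline.Admissible I → Metric.diam (DROnline.box I) ≤ D →
      ∀ init : ℕ → DROnline.E n, (∀ k, init k ∈ DROnline.box I) →
      ∀ F : Fin T → DROnline.Payoff (DROnline.box I) β G,
        MeasureTheory.Integrable
          (fun ω => DROnline.regret F (DROnline.play ε init F ω))
          (DROnline.noiseMeasure n T G ε) ∧
        ∫ ω, DROnline.regret F (DROnline.play ε init F ω) ∂(DROnline.noiseMeasure n T G ε) ≤
          C * ((T : ℝ) ^ (3 / 4 : ℝ) * √(Real.log T ^ (2.5 : ℝ)) / ε)) := by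
  refine ⟨fun T hT ε hε I hI init hinit => ⟨fun F ω t => ?_, fun F => ?_,
    DROnline.isDP_outputLaw hT hG hε hI hinit⟩, fun D ε₀ => ?_⟩
  · rw [DROnline.play_eq]
    exact DROnline.queryPoint_mem hI hinit F ω le_rfl t
  · have := DROnline.isProbabilityMeasure_noiseMeasure n hT hG hε
    exact Measure.isProbabilityMeasure_map
      (DROnline.measurable_play hT hε hI hinit F).aemeasurable
  · obtain ⟨C, hC⟩ := DROnline.exists_regret_bound n hβ hG D ε₀
    refine ⟨C, fun T hT ε hε hε₀ I hI hD init hinit F =>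
      ⟨DROnline.integrable_regret hT hG hε hI hinit F, ?_⟩⟩
    rw [DROnline.rate_eq]
    exact hC T hT ε hε hε₀ I hI hD init hinit F
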